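/- Let $p$ be a prime number and let $F$ be a field which contains a primitive $p$-th root of unity if $p$ is odd, and a primitive fourth root of unity if $p=2$. Let $$CR(F)=F(\sqrt[p^\infty]{F^\times})$$ be the compositum, inside a separable closure of $F$, of all the fields $F(\sqrt[p^m]{a},\zeta_{p^m})$ with $a\in F^\times$ and $m\ge 1$, where $\zeta_{p^m}$ denotes a primitive $p^m$-th root of unity. Suppose that $k\ge 1$ is an integer such that $\zeta_{p^k}\in F$ but $\zeta_{p^{k+1}}\notin F$. Then $CR(F)/F$ is a Galois extension, there is a set $I$ with $\#I+1=\dim_{\mathbb F_p}F^\times/(F^\times)^p$ (an equality of cardinal numbers), and for every such set $I$ there are isomorphisms of topological groups $$\mathrm{Gal}(CR(F)/F)\;\simeq\;\langle \sigma,\tau_i,\ i\in I\mid [\tau_i,\tau_j]=1\ \ \forall i,j\in I,\quad [\sigma,\tau_i]=\tau_i^{p^k}\ \ \forall i\in I\rangle\;\simeq\;\Bigl(\prod_{i\in I}\mathbb Z_p\Bigr)\rtimes\mathbb Z_p .$$ Here $[x,y]=xyx^{-1}y^{-1}$. The group in the middle is given by a pro-$p$ presentation: it is the quotient of the free pro-$p$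 group on the set $\{\sigma\}\sqcup\{\tau_i\mid i\in I\}$ (generators converging to $1$) by the closed normal subgroup generated by the stated relations. In the semidirect product, which carries the product topology, $z\in\mathbb Z_p$ acts on $\prod_{i\in I}\mathbb Z_p$ as multiplication by $(1+p^k)^z$. The second isomorphism can be chosen to send $\sigma$ to the generator $1$ of the factor $\mathbb Z_p$ and each $\tau_i$ to the $i$-th standard unit vector of $\prod_{i\in I}\mathbb Z_p$. -/

import Mathlib

universe u

namespace CyclotomicRadical

open scoped commutatorElement

/-! ### The cyclotomic radical extension -/

/-- `F(ᵖᵐ√a, ζ_{pᵐ})`: the subfield of the separable closure generated over `F` by the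
`p^m`-th roots of `a` and the `p^m`-th roots of unity. -/
noncomputable def radicalExt (F : Type*) [Field F] (p : ℕ) (a : Fˣ) (m : ℕ) :
    IntermediateField F (SeparableClosure F) :=
  IntermediateField.adjoin F
    ({x | x ^ p ^ m = algebraMap F (SeparableClosure F) (a : F)} ∪ {z | z ^ p ^ m = 1})

/-- `CR(F)`: the compositum of the fields `F(ᵖᵐ√a, ζ_{pᵐ})`, over all `a ∈ Fˣ` and `m ≥ 1`. -/
noncomputable def CR (F : Type*) [Field F] (p : ℕ) : IntermediateField F (SeparableClosure F) :=
  ⨆ (a : Fˣ) (m : ℕ) (_ : 1 ≤ m), radicalExt F p a m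

/-! ### Free pro-`p` groups and pro-`p` presentations -/

/-- The normal subgroups of `p`-power index of the free group on `X` that contain
all but finitely many of the free generators. -/
structure ProPIndex (p : ℕ) (X : Type*) where
  sub : Subgroup (FreeGroup X)
  normal : sub.Normal
  index_eq : ∃ n : ℕ, sub.index = p ^ n
  cofinite : {x : X | FreeGroup.of x ∉ sub}.Finite

instance ProPIndex.instNormal (p : ℕ) (X : Type*) (N : ProPIndex p X) : N.sub.Normal := N.normal

/-- The finite `p`-group `FreeGroup X / N`, with the discrete topology. -/
def ProPIndex.Quot {p : ℕ} {X : Type*} (N : ProPIndex p X) : Type _ := FreeGroup X ⧸ N.sub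

instance ProPIndex.instGroup {p : ℕ} {X : Type*} (N : ProPIndex p X) : Group N.Quot :=
  inferInstanceAs (Group (FreeGroup X ⧸ N.sub))

instance ProPIndex.instTopologicalSpace {p : ℕ} {X : Type*} (N : ProPIndex p X) : TopologicalSpace N.Quot := ⊥

instance ProPIndex.instDiscreteTopology {p : ℕ} {X : Type*} (N : ProPIndex p X) : DiscreteTopology N.Quot := ⟨rfl⟩

/-- The projection `FreeGroup X → FreeGroup X / N`. -/
def ProPIndex.proj {p : ℕ} {X : Type*} (N : ProPIndex p X) : FreeGroup X →* N.Quot :=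
  QuotientGroup.mk' N.sub

/-- The transition map `FreeGroup X / N → FreeGroup X / M` for `N ≤ M`. -/
def ProPIndex.map {p : ℕ} {X : Type*} (N M : ProPIndex p X) (h : N.sub ≤ M.sub) :
    N.Quot →* M.Quot :=
  QuotientGroup.map N.sub M.sub (MonoidHom.id _) h

/-- The inverse limit of the finite `p`-groups `FreeGroup X / N`, as a subgroup of their
product. -/
def freeProPSubgroup (p : ℕ) (X : Type*) : Subgroup (∀ N : ProPIndex p X, N.Quot) where
  carrier := {f | ∀ (N M : ProPIndex p X) (h : N.sub ≤ M.sub), N.map M h (f N) = f M}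
  mul_mem' := by
    intro f g hf hg N M h
    simp [hf N M h, hg N M h]
  one_mem' := by
    intro N M h
    simp
  inv_mem' := by
    intro f hf N M h
    simp [hf N M h]

/-- The free pro-`p` group on the set `X` (converging to `1`), with the inverse limit topology. -/
abbrev FreeProP (p : ℕ) (X : Type*) : Type _ := freeProPSubgroup p X

/-- The canonical map from the abstract free group on `X` to the free pro-`p` group on `X`. -/
def FreeProP.ofWord (p : ℕ) {X : Type*} : FreeGroup X →* FreeProP p X where
  toFun w := ⟨fun N => N.proj w, fun _ _ _ => rfl⟩
  map_one' := by
    ext N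
    simp
  map_mul' := by
    intro v w
    ext N
    simp

/-- The closed normal subgroup of the free pro-`p` group on `X` generated by the relators `R`. -/
def relatorSubgroup (p : ℕ) {X : Type*} (R : Set (FreeGroup X)) : Subgroup (FreeProP p X) :=
  (Subgroup.normalClosure (FreeProP.ofWord p '' R)).topologicalClosure

instance relatorSubgroup_normal (p : ℕ) {X : Type*} (R : Set (FreeGroup X)) : (relatorSubgroup p R).Normal :=
  Subgroup.is_normal_topologicalClosure _

/-- The pro-`p` group `⟨X ∣ R⟩` with generators `X` and relators `R`, with the quotient
topology. -/
abbrev ProPPresented (p : ℕ) {X : Type*} (R : Set (FreeGroup X)) : Type _ :=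
  FreeProP p X ⧸ relatorSubgroup p R

/-- The image of a generator in `⟨X ∣ R⟩`. -/
def ProPPresented.of (p : ℕ) {X : Type*} (R : Set (FreeGroup X)) (x : X) : ProPPresented p R :=
  QuotientGroup.mk (FreeProP.ofWord p (FreeGroup.of x))

/-! ### The presentation `⟨σ, τ_i ∣ [τ_i, τ_j] = 1, [σ, τ_i] = τ_i ^ (p ^ k)⟩`

Commutators are `⁅x, y⁆ = x * y * x⁻¹ * y⁻¹`. -/

/-- The free generator `σ`. -/
def sigmaWord (I : Type*) : FreeGroup (Option I) := FreeGroup.of none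

/-- The free generator `τ_i`. -/
def tauWord {I : Type*} (i : I) : FreeGroup (Option I) := FreeGroup.of (some i)

/-- The relators `[τ_i, τ_j]` and `[σ, τ_i] τ_i ^ (-p ^ k)`. -/
def crRelators (p k : ℕ) (I : Type*) : Set (FreeGroup (Option I)) :=
  {r | ∃ i j : I, r = ⁅tauWord i, tauWord j⁆} ∪
    {r | ∃ i : I, r = ⁅sigmaWord I, tauWord i⁆ * (tauWord i ^ p ^ k)⁻¹}

/-! ### The semidirect product `(∏_{i ∈ I} ℤ_p) ⋊ ℤ_p` -/

/-- `z ↦ (1 + p ^ k) ^ z` for `z ∈ ℤ_p`: the unique continuous additive character of `ℤ_p` with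
value `1 + p ^ k` at `1`. -/
noncomputable def onePlusPow (p k : ℕ) [Fact p.Prime] (hk : 1 ≤ k) : AddChar ℤ_[p] ℤ_[p] :=
  PadicInt.addChar_of_value_at_one ((p : ℤ_[p]) ^ k) <| by
    rw [tendsto_pow_atTop_nhds_zero_iff_norm_lt_one, norm_pow]
    exact pow_lt_one₀ (norm_nonneg _) (by rw [PadicInt.norm_p]; exact inv_lt_one_of_one_lt₀ (by exact_mod_cast (Fact.out : p.Prime).one_lt)) (by omega)

/-- The action of `ℤ_p` on `∏_{i ∈ I} ℤ_p` in which `z` multiplies every coordinate by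
`(1 + p ^ k) ^ z`. -/
noncomputable def crAction (p k : ℕ) [Fact p.Prime] (hk : 1 ≤ k) (I : Type*) :
    Multiplicative ℤ_[p] →* MulAut (Multiplicative (I → ℤ_[p])) where
  toFun z :=
    { toFun := fun v => Multiplicative.ofAdd (onePlusPow p k hk z.toAdd • v.toAdd)
      invFun := fun v => Multiplicative.ofAdd (onePlusPow p k hk (-z.toAdd) • v.toAdd)
      left_inv := fun v => by
        simp [smul_smul, ← AddChar.map_add_eq_mul]
      right_inv := fun v => by
        simp [smul_smul, ← AddChar.map_add_eq_mul]
      map_mul' := fun v w => by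
        simp [smul_add] }
  map_one' := by
    ext v
    simp
  map_mul' := by
    intro y z
    ext v
    simp [AddChar.map_add_eq_mul, smul_smul]

/-- The semidirect product `(∏_{i ∈ I} ℤ_p) ⋊ ℤ_p` for the action above. -/
abbrev CRSemidirect (p k : ℕ) [Fact p.Prime] (hk : 1 ≤ k) (I : Type*) : Type _ :=
  Multiplicative (I → ℤ_[p]) ⋊[crAction p k hk I] Multiplicative ℤ_[p]

/-- The product topology on a semidirect product. -/
instance semidirectTopology {N G : Type*} [Group N] [Group G] [TopologicalSpace N] [TopologicalSpace G]
    (φ : G →* MulAut N) : TopologicalSpace (N ⋊[φ] G) :=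
  TopologicalSpace.induced SemidirectProduct.equivProd inferInstance

end CyclotomicRadical

/-! Choose compatible `p`-power roots of unity `ζ_n` and compatible `p`-power roots of
representatives of a basis of `Fˣ/(Fˣ)^p` whose first member is `ζ_k`; this class is nonzero because
`ζ_{p^{k+1}} ∉ F`. An automorphism `s` of `CR(F)` acts on the `ζ_n` through a cyclotomic character
with values in `1 + p^k ℤ_p`, which equals `(1 + p^k)^{ℤ_p}` (for `p = 2` because `k ≥ 2`), and on
the roots of the `i`-th basis element through a Kummer cocycle `v_i ∈ ℤ_p`. The exponent `z` of the
character and the `v_i` give a continuous map from the Galois group to the semidirect product, and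
the cocycle rule is exactly the semidirect multiplication. Injectivity (`eq_one_of_relation_one`):
the chosen roots generate all radicals, by descent on the exponent. Surjectivity
(`surjective_of_relation`): a proper closed subgroup of a pro-`p` group is killed by a nontrivial
character of order `p`; such a character vanishing on the image would be a Kummer relation between
the basis elements modulo `p`-th powers. The presentation is treated separately
(`relatorSubgroup_eq_ker`): the free pro-`p` group maps onto the semidirect product, and every
finite `p`-quotient in which the relators vanish factors through the semidirect product, so the
kernel is the closed normal closure of the relators. -/

namespace CyclotomicRadical

open Topology

open scoped commutatorElement

/-! ### Powers with `p`-adic exponents of elements of `p`-power order -/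

section PadicPow

variable {p : ℕ} [Fact p.Prime]

/-- `q ^ x` for a `p`-adic integer `x` and an element `q` with `q ^ p ^ n = 1`. -/
noncomputable def padicPow {M : Type*} [Monoid M] (n : ℕ) (q : M) (x : ℤ_[p]) : M :=
  q ^ (PadicInt.toZModPow n x).val

theorem isLocallyConstant_toZModPow (n : ℕ) :
    IsLocallyConstant (PadicInt.toZModPow n : ℤ_[p] → ZMod (p ^ n)) := by
  rw [IsLocallyConstant.iff_exists_open]
  intro x
  refine ⟨Metric.closedBall x ((p : ℝ) ^ (-n : ℤ)),
    IsUltrametricDist.isOpen_closedBall x ?_, Metric.mem_closedBall_self ?_, fun y hy => ?_⟩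
  · have : (p : ℝ) ≠ 0 := by exact_mod_cast (Fact.out : p.Prime).ne_zero
    positivity
  · positivity
  · rw [Metric.mem_closedBall, dist_eq_norm, PadicInt.norm_le_pow_iff_mem_span_pow,
      ← PadicInt.ker_toZModPow, RingHom.mem_ker, map_sub, sub_eq_zero] at hy
    exact hy

theorem toZModPow_eq_zero_iff {n : ℕ} {x : ℤ_[p]} :
    PadicInt.toZModPow n x = 0 ↔ (p : ℤ_[p]) ^ n ∣ x := by
  rw [← RingHom.mem_ker, PadicInt.ker_toZModPow, Ideal.mem_span_singleton]

theorem pow_tendsto_zero (x : ℤ_[p]) (U : Set ℤ_[p]) (hU : U ∈ 𝓝 0) :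
    ∃ N, ∀ n ≥ N, (p : ℤ_[p]) ^ n * x ∈ U := by
  have h : Filter.Tendsto (fun n : ℕ => (p : ℤ_[p]) ^ n * x) Filter.atTop (𝓝 (0 * x)) := by
    refine Filter.Tendsto.mul_const x ?_
    rw [tendsto_pow_atTop_nhds_zero_iff_norm_lt_one, PadicInt.norm_p]
    exact inv_lt_one_of_one_lt₀ (by exact_mod_cast (Fact.out : p.Prime).one_lt)
  rw [zero_mul] at h
  exact Filter.eventually_atTop.1 (h.eventually hU)

variable {M : Type*} [Monoid M] {n : ℕ} {q : M}

theorem padicPow_eq_pow (hq : q ^ p ^ n = 1) {x : ℤ_[p]} {j : ℕ}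
    (h : PadicInt.toZModPow n x = j) : padicPow n q x = q ^ j := by
  rw [padicPow, h, ZMod.val_natCast]
  conv_rhs => rw [← Nat.mod_add_div j (p ^ n), pow_add, pow_mul, hq, one_pow, mul_one]

/-- Reduction modulo `p` of `p`-adic integers. -/
noncomputable def padicRed (p : ℕ) [Fact p.Prime] : ℤ_[p] →+* ZMod p :=
  (ZMod.castHom (dvd_of_eq (pow_one p).symm) (ZMod p)).comp (PadicInt.toZModPow 1)

theorem isLocallyConstant_padicRed : IsLocallyConstant (padicRed p) :=
  (isLocallyConstant_toZModPow 1).comp _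

theorem natCast_val_toZModPow_one (x : ℤ_[p]) :
    (((PadicInt.toZModPow 1 x).val : ℕ) : ZMod p) = padicRed p x := by
  rw [ZMod.natCast_val]; rfl

theorem padicPow_natCast (hq : q ^ p ^ n = 1) (j : ℕ) : padicPow n q (j : ℤ_[p]) = q ^ j :=
  padicPow_eq_pow hq (map_natCast _ _)

theorem padicPow_one (hq : q ^ p ^ n = 1) : padicPow n q (1 : ℤ_[p]) = q := by
  simpa using padicPow_natCast (p := p) hq 1

theorem padicPow_zero : padicPow n q (0 : ℤ_[p]) = 1 := by
  simp [padicPow]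

theorem padicPow_add (hq : q ^ p ^ n = 1) (x y : ℤ_[p]) :
    padicPow n q (x + y) = padicPow n q x * padicPow n q y := by
  rw [padicPow_eq_pow hq (j := (PadicInt.toZModPow n x).val + (PadicInt.toZModPow n y).val)]
  · rw [pow_add]; rfl
  · simp

theorem padicPow_mul (hq : q ^ p ^ n = 1) (x y : ℤ_[p]) :
    padicPow n q (x * y) = padicPow n (padicPow n q x) y := by
  rw [padicPow_eq_pow hq (j := (PadicInt.toZModPow n x).val * (PadicInt.toZModPow n y).val)]
  · rw [pow_mul]; rfl
  · simp

theorem map_padicPow {N E : Type*} [Monoid N] [FunLike E M N] [MonoidHomClass E M N] (φ : E)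
    (x : ℤ_[p]) : φ (padicPow n q x) = padicPow n (φ q) x := map_pow _ _ _

theorem isLocallyConstant_padicPow (n : ℕ) (q : M) :
    IsLocallyConstant (padicPow n q : ℤ_[p] → M) :=
  (isLocallyConstant_toZModPow n).comp fun c => q ^ c.val

/-- The homomorphism `x ↦ q ^ x` from `ℤ_p` to a group in which `q ^ p ^ n = 1`. -/
noncomputable def padicPowHom (n : ℕ) (q : M) (hq : q ^ p ^ n = 1) :
    Multiplicative ℤ_[p] →* M where
  toFun x := padicPow n q x.toAdd
  map_one' := padicPow_zero
  map_mul' _ _ := padicPow_add hq _ _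

end PadicPow

/-! ### Compatible systems of `p`-power roots of unity as a copy of `ℤ_p` -/

section RootSystem

variable {p : ℕ} [Fact p.Prime]

theorem pow_prime_pow_eq_one {p : ℕ} {M : Type*} [Monoid M] {ζ : ℕ → M} (h0 : ζ 0 = 1)
    (hζ : ∀ n, ζ (n + 1) ^ p = ζ n) (n : ℕ) : ζ n ^ p ^ n = 1 := by
  induction n with
  | zero => simpa using h0
  | succ n ih => rw [pow_succ', pow_mul, hζ, ih]

/-- A compatible system of `p`-power roots of unity is a `p`-adic power of a compatible system of
primitive roots of unity. -/
theorem exists_padicPow_eq {K : Type*} [Field K] {ζ : ℕ → K}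
    (hprim : ∀ n, IsPrimitiveRoot (ζ n) (p ^ n)) (hζ : ∀ n, ζ (n + 1) ^ p = ζ n)
    {u : ℕ → K} (hu0 : u 0 = 1) (hu : ∀ n, u (n + 1) ^ p = u n) :
    ∃ x : ℤ_[p], ∀ n, u n = padicPow n (ζ n) x := by
  have hpn (n : ℕ) : p ^ n ≠ 0 := pow_ne_zero _ (Fact.out : p.Prime).ne_zero
  have hex (n : ℕ) : ∃ j : ℕ, ζ n ^ j = u n := by
    have : NeZero (p ^ n) := ⟨hpn n⟩
    obtain ⟨j, -, hj⟩ := (hprim n).eq_pow_of_pow_eq_one (pow_prime_pow_eq_one hu0 hu n)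
    exact ⟨j, hj⟩
  choose j hj using hex
  -- The exponents are determined modulo `p ^ n` only; compatibility makes them a Cauchy sequence,
  -- whose limit is the required exponent.
  have hdvd (n : ℕ) : ((p : ℤ)) ^ n ∣ (j (n + 1) : ℤ) - (j n : ℤ) := by
    have h1 : ζ n ^ j (n + 1) = ζ n ^ j n := by
      rw [hj, ← hu, ← hj, ← hζ, ← pow_mul, ← pow_mul, mul_comm]
    rw [((hprim n).isOfFinOrder (hpn n)).pow_eq_pow_iff_modEq, ← (hprim n).eq_orderOf] at h1
    rw [← Nat.cast_pow]
    exact Nat.modEq_iff_dvd.1 h1.symm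
  refine ⟨PadicInt.ofIntSeq _
    (PadicInt.isCauSeq_padicNorm_of_pow_dvd_sub (fun n => (j n : ℤ)) p hdvd), fun n => ?_⟩
  rw [← hj]
  refine (padicPow_eq_pow (hprim n).pow_eq_one ?_).symm
  rw [PadicInt.toZModPow_ofIntSeq_of_pow_dvd_sub _ p hdvd n]
  simp

theorem padicPow_injective {K : Type*} [Field K] {ζ : ℕ → K}
    (hprim : ∀ n, IsPrimitiveRoot (ζ n) (p ^ n)) {x y : ℤ_[p]}
    (h : ∀ n, padicPow n (ζ n) x = padicPow n (ζ n) y) : x = y := by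
  refine PadicInt.ext_of_toZModPow.1 fun n => ?_
  have : NeZero (p ^ n) := ⟨pow_ne_zero _ (Fact.out : p.Prime).ne_zero⟩
  exact ZMod.val_injective _ ((hprim n).pow_inj (ZMod.val_lt _) (ZMod.val_lt _) (h n))

end RootSystem

/-! ### The isomorphism of `ℤ_p` with `1 + p^k ℤ_p` -/

section OnePlusPow

variable {p k : ℕ} [Fact p.Prime] (hk : 1 ≤ k)

theorem continuous_onePlusPow : Continuous (onePlusPow p k hk) :=
  PadicInt.continuous_addChar_of_value_at_one _

theorem onePlusPow_one : onePlusPow p k hk 1 = 1 + (p : ℤ_[p]) ^ k :=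
  PadicInt.addChar_of_value_at_one_def _

theorem onePlusPow_natCast (n : ℕ) : onePlusPow p k hk n = (1 + (p : ℤ_[p]) ^ k) ^ n := by
  rw [← onePlusPow_one hk, ← AddChar.map_nsmul_eq_pow, nsmul_eq_mul, mul_one]

theorem onePlusPow_mul_natCast (x : ℤ_[p]) (n : ℕ) :
    onePlusPow p k hk (x * n) = onePlusPow p k hk x ^ n := by
  rw [← AddChar.map_nsmul_eq_pow, nsmul_eq_mul, mul_comm]

/-- If `x ≠ 0`, write `x` as a unit times `p ^ v`. By density of `ℕ` the character is trivial on `x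
ℤ_p`, hence at `p ^ v`, and `(1 + p^k)^(p^v) = 1` is false for natural numbers. -/
theorem onePlusPow_eq_one {x : ℤ_[p]} (hx : onePlusPow p k hk x = 1) : x = 0 := by
  by_contra h0
  have h1 (y : ℤ_[p]) : onePlusPow p k hk (x * y) = 1 := by
    refine PadicInt.denseRange_natCast.induction_on y ?_ fun n => ?_
    · exact isClosed_eq ((continuous_onePlusPow hk).comp (continuous_const.mul continuous_id))
        continuous_const
    · rw [onePlusPow_mul_natCast, hx, one_pow]
  have h2 := h1 ((PadicInt.unitCoeff h0)⁻¹ : ℤ_[p]ˣ)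
  conv at h2 => enter [1, 2, 1]; rw [PadicInt.unitCoeff_spec h0]
  rw [mul_right_comm, Units.mul_inv, one_mul, ← Nat.cast_pow, onePlusPow_natCast] at h2
  have hp := (Fact.out : p.Prime)
  have h3 : (1 + p ^ k) ^ p ^ x.valuation = 1 := by exact_mod_cast h2
  rw [Nat.pow_eq_one] at h3
  have := pow_pos hp.pos k
  rcases h3 with h3 | h3
  · omega
  · exact absurd h3 (pow_ne_zero _ hp.ne_zero)

theorem onePlusPow_injective : Function.Injective (onePlusPow p k hk) := fun x y h => by
  have h1 : onePlusPow p k hk (x + -y) = 1 := by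
    rw [AddChar.map_add_eq_mul, h, ← AddChar.map_add_eq_mul, add_neg_cancel,
      AddChar.map_zero_eq_one]
  exact add_neg_eq_zero.1 (onePlusPow_eq_one hk h1)

theorem isUnit_onePlusPow (x : ℤ_[p]) : IsUnit (onePlusPow p k hk x) :=
  IsUnit.of_mul_eq_one (onePlusPow p k hk (-x)) <| by
    rw [← AddChar.map_add_eq_mul, add_neg_cancel, AddChar.map_zero_eq_one]

theorem pow_dvd_onePlusPow_sub_one (x : ℤ_[p]) : (p : ℤ_[p]) ^ k ∣ onePlusPow p k hk x - 1 := by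
  rw [← toZModPow_eq_zero_iff, map_sub, map_one, sub_eq_zero]
  refine PadicInt.denseRange_natCast.induction_on x ?_ fun n => ?_
  · have h := ((isLocallyConstant_toZModPow (p := p) k).comp_continuous
      (continuous_onePlusPow hk)).isClosed_fiber 1
    exact h
  · rw [onePlusPow_natCast, map_pow, map_add, toZModPow_eq_zero_iff.2 dvd_rfl, map_one, add_zero,
      one_pow]

theorem one_add_pow_prime_pow {p k : ℕ} [Fact p.Prime] (hk : 1 ≤ k) (h2 : p = 2 → 2 ≤ k) (n : ℕ) :
    ∃ y : ℤ_[p], (1 + (p : ℤ_[p]) ^ k) ^ p ^ n = 1 + (p : ℤ_[p]) ^ (k + n) * (1 + p * y) := by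
  have hp := (Fact.out : p.Prime)
  obtain ⟨y, hy⟩ := ZMod.exists_one_add_mul_pow_prime_pow_eq (R := ℤ_[p]) (p := p)
    (u := (p : ℤ_[p]) ^ k) (v := p) hp (dvd_pow_self _ (by omega)) (by
      rw [← pow_mul, ← pow_succ', ← pow_succ]
      refine pow_dvd_pow _ ?_
      rcases hp.eq_two_or_odd' with h | h
      -- The condition is `k + 2 ≤ k * p`; for `p = 2` it says `k ≥ 2`, and for `p ≥ 3` it follows
      -- from `k ≥ 1`.
      · have := h2 h; subst h; omega
      · have h3 : 3 ≤ p := by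
          rcases h with ⟨r, hr⟩
          have := hp.two_le
          omega
        have := Nat.mul_le_mul_left k h3
        omega) 1 n
  refine ⟨y, ?_⟩
  rw [mul_one] at hy
  rw [hy]; ring

/-- Successive approximation: an error at level `p^(k+n)` is corrected by a factor `((1 +
p^k)^(p^n))^j`, with `j` the leading digit of the relative error. The image is compact, hence
closed, so approximation suffices. -/
theorem exists_onePlusPow_eq (h2 : p = 2 → 2 ≤ k) {u : ℤ_[p]} (hu : (p : ℤ_[p]) ^ k ∣ u - 1) :
    ∃ z, onePlusPow p k hk z = u := by
  have happrox (n : ℕ) : ∃ z, (p : ℤ_[p]) ^ (k + n) ∣ u - onePlusPow p k hk z := by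
    induction n with
    | zero => exact ⟨0, by simpa using hu⟩
    | succ n ih =>
      obtain ⟨z, t, ht⟩ := ih
      obtain ⟨w, hw⟩ := isUnit_onePlusPow hk z
      obtain ⟨y, hy⟩ := one_add_pow_prime_pow hk h2 n
      set c : ℤ_[p] := t * (w⁻¹ : ℤ_[p]ˣ) with hc
      have hcz : (p : ℤ_[p]) ∣ c - (c.appr 1 : ℕ) := by
        simpa [Ideal.mem_span_singleton] using PadicInt.appr_spec 1 c
      set j := c.appr 1
      refine ⟨z + (p ^ n : ℕ) * (j : ℕ), ?_⟩
      rw [AddChar.map_add_eq_mul, onePlusPow_mul_natCast, onePlusPow_natCast, hy]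
      obtain ⟨d, hd⟩ := hcz
      obtain ⟨b, hb⟩ : ∃ b, (1 + (p : ℤ_[p]) ^ (k + n) * (1 + p * y)) ^ j =
          1 + j * ((p : ℤ_[p]) ^ (k + n) * (1 + p * y)) +
            b * ((p : ℤ_[p]) ^ (k + n) * (1 + p * y)) ^ 2 := by
        generalize (p : ℤ_[p]) ^ (k + n) * (1 + p * y) = e
        induction j with
        | zero => exact ⟨0, by simp⟩
        | succ j ih =>
          obtain ⟨b, hb⟩ := ih
          exact ⟨b + b * e + j, by rw [pow_succ, hb]; push_cast; ring⟩
      have ht' : t = w * (j + p * d) := by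
        have : (w : ℤ_[p]) * c = t := by rw [hc, mul_left_comm, Units.mul_inv, mul_one]
        rw [← this, ← hd]; ring
      have hu' : u = w + (p : ℤ_[p]) ^ (k + n) * (w * (j + p * d)) := by
        rw [← ht', hw, ← ht]; ring
      -- Since `k ≥ 1`, the quadratic remainder `p^(2(k+n))` is divisible by `p^(k+n+1)`; `k = 1 +
      -- m` makes the quotient explicit.
      obtain ⟨m, rfl⟩ := Nat.exists_eq_add_of_le hk
      rw [hb, ← hw]
      refine ⟨w * d - w * j * y - w * b * (p : ℤ_[p]) ^ (m + n) * (1 + p * y) ^ 2, ?_⟩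
      rw [hu']
      ring
  choose z hz using happrox
  have hcl : IsClosed (Set.range (onePlusPow p k hk)) :=
    (isCompact_range (continuous_onePlusPow hk)).isClosed
  have : u ∈ closure (Set.range (onePlusPow p k hk)) := by
    rw [Metric.mem_closure_range_iff]
    intro ε hε
    obtain ⟨n, hn⟩ := PadicInt.exists_pow_neg_lt p hε
    refine ⟨z n, lt_of_le_of_lt ?_ hn⟩
    rw [dist_eq_norm, PadicInt.norm_le_pow_iff_mem_span_pow, Ideal.mem_span_singleton]
    exact (pow_dvd_pow _ (by omega)).trans (hz n)
  rw [hcl.closure_eq] at this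
  exact this

end OnePlusPow

/-! ### Continuous homomorphisms from closed graphs -/

section Topology

/-- A multiplicatively closed, closed functional relation between compact Hausdorff groups is the
graph of a continuous homomorphism. -/
theorem exists_continuousMonoidHom_of_isClosed {A B : Type*} [Group A] [TopologicalSpace A]
    [Group B] [TopologicalSpace B] [CompactSpace B] {Γ : Set (A × B)} (hcl : IsClosed Γ)
    (hmul : ∀ x ∈ Γ, ∀ y ∈ Γ, x * y ∈ Γ) (hex : ∀ a, ∃! b, (a, b) ∈ Γ) :
    ∃ φ : A →ₜ* B, ∀ a, (a, φ a) ∈ Γ := by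
  choose g hg hg' using hex
  refine ⟨{ toMonoidHom := MonoidHom.mk' g fun x y =>
    (hg' _ _ (hmul _ (hg x) _ (hg y))).symm, continuous_toFun := ?_ }, hg⟩
  change Continuous g
  rw [continuous_iff_isClosed]
  intro s hs
  -- The preimage of a closed set is the projection of a closed part of the graph along the compact
  -- factor `B`, hence closed.
  have h : g ⁻¹' s = Prod.fst '' (Γ ∩ Prod.snd ⁻¹' s) := by
    ext a
    constructor
    · exact fun ha => ⟨(a, g a), ⟨hg a, ha⟩, rfl⟩
    · rintro ⟨⟨a', b⟩, ⟨h1, h2⟩, rfl⟩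
      rw [Set.mem_preimage, ← hg' _ _ h1]
      exact h2
  rw [h]
  exact isClosedMap_fst_of_compactSpace _ (hcl.inter (hs.preimage continuous_snd))

/-- A bijective continuous homomorphism from a compact group to a Hausdorff group is an
isomorphism of topological groups. -/
noncomputable def continuousMulEquivOfBijective {A B : Type*} [Group A] [TopologicalSpace A]
    [Group B] [TopologicalSpace B] [CompactSpace A] [T2Space B] (φ : A →* B)
    (hφ : Continuous φ) (hb : Function.Bijective φ) : A ≃ₜ* B :=
  { MulEquiv.ofBijective φ hb with
    continuous_toFun := hφ
    continuous_invFun :=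
      (Continuous.homeoOfEquivCompactToT2 (f := Equiv.ofBijective φ hb) hφ).continuous_invFun }

end Topology

/-! ### The semidirect product as a pro-`p` group, its generators and its characters of order `p` -/

section Semidirect

variable {p k : ℕ} [Fact p.Prime] {hk : 1 ≤ k} {I : Type*}

/-- The element `(v, z)` of the semidirect product. -/
def semiMk (v : I → ℤ_[p]) (z : ℤ_[p]) : CRSemidirect p k hk I :=
  ⟨Multiplicative.ofAdd v, Multiplicative.ofAdd z⟩

theorem semiMk_mul (v w : I → ℤ_[p]) (y z : ℤ_[p]) :
    (semiMk v y * semiMk w z : CRSemidirect p k hk I) =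
      semiMk (v + onePlusPow p k hk y • w) (y + z) := rfl

theorem semiMk_surjective (g : CRSemidirect p k hk I) : ∃ v z, g = semiMk v z :=
  ⟨g.left.toAdd, g.right.toAdd, rfl⟩

theorem semiMk_inj {v w : I → ℤ_[p]} {y z : ℤ_[p]} :
    (semiMk v y : CRSemidirect p k hk I) = semiMk w z ↔ v = w ∧ y = z := by
  constructor
  · intro h
    exact ⟨congrArg (fun g => g.left.toAdd) h, congrArg (fun g => g.right.toAdd) h⟩
  · rintro ⟨rfl, rfl⟩; rfl

theorem semiMk_zero : (semiMk 0 0 : CRSemidirect p k hk I) = 1 := rfl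

theorem semiMk_eq_mul (v : I → ℤ_[p]) (z : ℤ_[p]) :
    (semiMk v z : CRSemidirect p k hk I) = semiMk v 0 * semiMk 0 z := by
  rw [semiMk_mul, smul_zero, add_zero, zero_add]

theorem semiMk_inl_pow (v : I → ℤ_[p]) (n : ℕ) :
    (semiMk v 0 : CRSemidirect p k hk I) ^ n = semiMk (n • v) 0 := by
  induction n with
  | zero => simp [semiMk_zero]
  | succ n ih => rw [pow_succ, ih, semiMk_mul]; simp [add_mul]

theorem semiMk_pow (v : I → ℤ_[p]) (z : ℤ_[p]) (n : ℕ) :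
    ∃ w, (semiMk v z : CRSemidirect p k hk I) ^ n = semiMk w (n • z) := by
  induction n with
  | zero => exact ⟨0, by simp [semiMk_zero]⟩
  | succ n ih =>
    obtain ⟨w, hw⟩ := ih
    exact ⟨_, by rw [pow_succ, hw, semiMk_mul, succ_nsmul]⟩

/-- The semidirect product is homeomorphic to the product of its factors. -/
def semiHomeo (p k : ℕ) [Fact p.Prime] (hk : 1 ≤ k) (I : Type*) :
    CRSemidirect p k hk I ≃ₜ (I → ℤ_[p]) × ℤ_[p] where
  toFun g := (g.left.toAdd, g.right.toAdd)
  invFun x := semiMk x.1 x.2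
  continuous_toFun := by
    have h : Continuous (SemidirectProduct.equivProd : CRSemidirect p k hk I → _) :=
      continuous_induced_dom
    exact (continuous_toAdd.comp (continuous_fst.comp h)).prodMk
      (continuous_toAdd.comp (continuous_snd.comp h))
  continuous_invFun := by
    refine continuous_induced_rng.2 ?_
    exact (continuous_ofAdd.comp continuous_fst).prodMk (continuous_ofAdd.comp continuous_snd)

theorem continuous_semiMk {X : Type*} [TopologicalSpace X] {v : X → I → ℤ_[p]} {z : X → ℤ_[p]}
    (hv : Continuous v) (hz : Continuous z) :
    Continuous fun x => (semiMk (v x) (z x) : CRSemidirect p k hk I) :=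
  (semiHomeo p k hk I).symm.continuous.comp (hv.prodMk hz)

theorem continuous_left : Continuous fun g : CRSemidirect p k hk I => g.left.toAdd :=
  continuous_fst.comp (semiHomeo p k hk I).continuous

theorem continuous_right : Continuous fun g : CRSemidirect p k hk I => g.right.toAdd :=
  continuous_snd.comp (semiHomeo p k hk I).continuous

instance : CompactSpace (CRSemidirect p k hk I) := (semiHomeo p k hk I).symm.compactSpace

instance : T2Space (CRSemidirect p k hk I) := (semiHomeo p k hk I).symm.t2Space

instance : TotallyDisconnectedSpace (CRSemidirect p k hk I) :=
  (semiHomeo p k hk I).symm.totallyDisconnectedSpace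

instance : IsTopologicalGroup (CRSemidirect p k hk I) where
  continuous_mul := by
    have h := continuous_onePlusPow (p := p) hk
    refine continuous_semiMk (v := fun x : CRSemidirect p k hk I × CRSemidirect p k hk I =>
      x.1.left.toAdd + onePlusPow p k hk x.1.right.toAdd • x.2.left.toAdd)
      (z := fun x => x.1.right.toAdd + x.2.right.toAdd) ?_ ?_
    · exact (continuous_left.comp continuous_fst).add
        ((h.comp (continuous_right.comp continuous_fst)).smul
          (continuous_left.comp continuous_snd))
    · exact (continuous_right.comp continuous_fst).add (continuous_right.comp continuous_snd)
  continuous_inv := by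
    have h := continuous_onePlusPow (p := p) hk
    refine continuous_semiMk (v := fun x : CRSemidirect p k hk I =>
      onePlusPow p k hk (-x.right.toAdd) • (-x.left.toAdd)) (z := fun x => -x.right.toAdd) ?_ ?_
    · exact (h.comp continuous_right.neg).smul continuous_left.neg
    · exact continuous_right.neg

theorem tendsto_pow_smul (v : I → ℤ_[p]) :
    Filter.Tendsto (fun n : ℕ => (p ^ n) • v) Filter.atTop (𝓝 0) := by
  rw [tendsto_pi_nhds]
  intro i
  rw [Filter.tendsto_def]
  intro U hU
  obtain ⟨N, hN⟩ := pow_tendsto_zero (v i) U hU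
  refine Filter.mem_atTop_sets.2 ⟨N, fun n hn => ?_⟩
  simpa using hN n hn

/-- Elements of the semidirect product have `p`-power order modulo every open subgroup. -/
theorem exists_pow_mem (U : Subgroup (CRSemidirect p k hk I)) [U.Normal]
    (hU : IsOpen (U : Set (CRSemidirect p k hk I))) (g : CRSemidirect p k hk I) :
    ∃ n : ℕ, g ^ p ^ n ∈ U := by
  obtain ⟨v, z, rfl⟩ := semiMk_surjective g
  have h1 : ∀ᶠ n : ℕ in Filter.atTop, (semiMk 0 ((p ^ n) • z) : CRSemidirect p k hk I) ∈ U := by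
    have h := tendsto_pow_smul (p := p) (fun _ : Unit => z)
    rw [tendsto_pi_nhds] at h
    exact (((continuous_semiMk continuous_const continuous_id).tendsto 0).comp (h ())).eventually
      (hU.mem_nhds (by exact U.one_mem))
  obtain ⟨n, hn⟩ := h1.exists
  -- Modulo `U` the `p^n`-th power has lost its `ℤ_p`-component; what remains lies in the abelian
  -- factor, where a further `p^m`-th power falls into `U`.
  obtain ⟨w, hw⟩ := semiMk_pow (k := k) (hk := hk) v z (p ^ n)
  have h2 : ∀ᶠ m : ℕ in Filter.atTop, (semiMk ((p ^ m) • w) 0 : CRSemidirect p k hk I) ∈ U :=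
    (((continuous_semiMk continuous_id continuous_const).tendsto 0).comp
      (tendsto_pow_smul w)).eventually (hU.mem_nhds (by exact U.one_mem))
  obtain ⟨m, hm⟩ := h2.exists
  refine ⟨n + m, ?_⟩
  rw [← QuotientGroup.eq_one_iff] at hn hm ⊢
  rw [pow_add, pow_mul, hw, semiMk_eq_mul]
  rw [QuotientGroup.mk_pow, QuotientGroup.mk_mul, hn, mul_one, ← QuotientGroup.mk_pow,
    semiMk_inl_pow, hm]

theorem isPGroup_quotient (U : Subgroup (CRSemidirect p k hk I)) [U.Normal]
    (hU : IsOpen (U : Set (CRSemidirect p k hk I))) :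
    IsPGroup p (CRSemidirect p k hk I ⧸ U) := by
  intro g
  induction g using QuotientGroup.induction_on with
  | H g =>
    obtain ⟨n, hn⟩ := exists_pow_mem U hU g
    exact ⟨n, by rw [← QuotientGroup.mk_pow]; exact (QuotientGroup.eq_one_iff _).2 hn⟩

theorem exists_index_eq_pow (U : Subgroup (CRSemidirect p k hk I)) [U.Normal]
    (hU : IsOpen (U : Set (CRSemidirect p k hk I))) : ∃ n, U.index = p ^ n := by
  have := Subgroup.quotient_finite_of_isOpen U hU
  exact IsPGroup.iff_card.1 (isPGroup_quotient U hU)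

open Classical in
/-- The standard topological generators of the semidirect product. -/
noncomputable def semiGen (p k : ℕ) [Fact p.Prime] (hk : 1 ≤ k) (I : Type*) :
    Option I → CRSemidirect p k hk I
  | none => semiMk 0 1
  | some i => semiMk (Pi.single i 1) 0

/-- In the product topology the unit vectors tend to `0` along the cofinite filter; thus the
generators converge to `1`, as a free pro-`p` group on an infinite set demands. -/
theorem finite_semiGen_notMem (U : Subgroup (CRSemidirect p k hk I))
    (hU : IsOpen (U : Set (CRSemidirect p k hk I))) :
    {i | semiGen p k hk I (some i) ∉ U}.Finite := by
  classical
  have h : Filter.Tendsto (fun i : I => (Pi.single i 1 : I → ℤ_[p])) Filter.cofinite (𝓝 0) := by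
    rw [tendsto_pi_nhds]
    intro j
    refine tendsto_const_nhds.congr' ?_
    filter_upwards [(Set.finite_singleton j).compl_mem_cofinite] with i hi
    rw [Pi.single_eq_of_ne (fun h => hi h.symm), Pi.zero_apply]
  have h2 := (((continuous_semiMk (p := p) (k := k) (hk := hk) continuous_id
    (continuous_const (y := 0))).tendsto 0).comp h).eventually (hU.mem_nhds (by exact U.one_mem))
  rw [Filter.eventually_cofinite] at h2
  convert! h2

/-- A closed subgroup containing the standard generators is everything. -/
theorem eq_top_of_semiGen_mem {H : Subgroup (CRSemidirect p k hk I)}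
    (hH : IsClosed (H : Set (CRSemidirect p k hk I))) (hgen : ∀ x, semiGen p k hk I x ∈ H) :
    H = ⊤ := by
  classical
  have hr (z : ℤ_[p]) : semiMk 0 z ∈ H := by
    refine PadicInt.denseRange_natCast.induction_on z
      (hH.preimage (continuous_semiMk continuous_const continuous_id)) fun n => ?_
    induction n with
    | zero => exact H.one_mem
    | succ n ih =>
      have h1 := H.mul_mem ih (hgen none)
      rw [semiGen, semiMk_mul] at h1
      simpa using h1
  have hl (i : I) (x : ℤ_[p]) : semiMk (Pi.single i x) 0 ∈ H := by
    refine PadicInt.denseRange_natCast.induction_on x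
      (hH.preimage (continuous_semiMk (continuous_single i) continuous_const)) fun n => ?_
    have h := H.pow_mem (hgen (some i)) n
    rw [semiGen, semiMk_inl_pow, ← Pi.single_smul] at h
    simpa using h
  have hs (v : I → ℤ_[p]) (S : Finset I) : semiMk (∑ i ∈ S, Pi.single i (v i)) 0 ∈ H := by
    induction S using Finset.induction_on with
    | empty => exact H.one_mem
    | insert i S hi ih =>
      have h := H.mul_mem (hl i (v i)) ih
      rw [semiMk_mul] at h
      rw [Finset.sum_insert hi]
      simpa using h
  have ht (v : I → ℤ_[p]) :
      Filter.Tendsto (fun S : Finset I => ∑ i ∈ S, Pi.single i (v i)) Filter.atTop (𝓝 v) := by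
    rw [tendsto_pi_nhds]
    intro j
    refine tendsto_const_nhds.congr' ?_
    filter_upwards [Filter.mem_atTop {j}] with S hS
    rw [Finset.sum_apply, Finset.sum_pi_single, if_pos (hS (Finset.mem_singleton_self j))]
  rw [eq_top_iff]
  intro g _
  obtain ⟨v, z, rfl⟩ := semiMk_surjective g
  rw [semiMk_eq_mul]
  refine H.mul_mem ?_ (hr z)
  exact hH.mem_of_tendsto (((continuous_semiMk continuous_id continuous_const).tendsto v).comp
    (ht v)) (Filter.Eventually.of_forall (hs v))

theorem denseRange_lift_semiGen : DenseRange (FreeGroup.lift (semiGen p k hk I)) := by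
  have h := eq_top_of_semiGen_mem
    (H := (FreeGroup.lift (semiGen p k hk I)).range.topologicalClosure)
    (Subgroup.isClosed_topologicalClosure _)
    fun x => Subgroup.le_topologicalClosure _ ⟨FreeGroup.of x, by simp⟩
  intro g
  have h1 : g ∈ (FreeGroup.lift (semiGen p k hk I)).range.topologicalClosure :=
    h ▸ Subgroup.mem_top g
  exact h1

/-- A proper closed subgroup is contained in the kernel of a nontrivial continuous homomorphism to
a group of order `p`. -/
theorem exists_hom_of_closed_ne_top {H : Subgroup (CRSemidirect p k hk I)}
    (hH : IsClosed (H : Set (CRSemidirect p k hk I))) (hne : H ≠ ⊤) :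
    ∃ ψ : CRSemidirect p k hk I →* Multiplicative (ZMod p),
      IsOpen (ψ.ker : Set (CRSemidirect p k hk I)) ∧ H ≤ ψ.ker ∧ ψ ≠ 1 := by
  have hp := (Fact.out : p.Prime)
  obtain ⟨N, hNo, hHN, hN⟩ : ∃ N : Subgroup (CRSemidirect p k hk I),
      IsOpen (N : Set (CRSemidirect p k hk I)) ∧ H ≤ N ∧ N ≠ ⊤ := by
    by_contra! hcon
    have h := ProfiniteGrp.closedSubgroup_eq_sInf_open (⟨H, hH⟩ : ClosedSubgroup _)
    refine hne (h.trans (eq_top_iff.2 (le_sInf fun N hN => ?_)))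
    rw [hcon N hN.1 hN.2]
  obtain ⟨U, hU⟩ := ProfiniteGrp.exist_openNormalSubgroup_sub_open_nhds_of_one hNo N.one_mem
  have hUo := U.isOpen
  set V : Subgroup (CRSemidirect p k hk I) := U.toSubgroup with hV
  have hVn : V.Normal := U.isNormal'
  have hVN : V ≤ N := hU
  have hfin : Finite (CRSemidirect p k hk I ⧸ V) := Subgroup.quotient_finite_of_isOpen V hUo
  have hpQ := isPGroup_quotient V hUo
  obtain ⟨m, hm⟩ := IsPGroup.iff_card.1 hpQ
  set N' := N.map (QuotientGroup.mk' V) with hN'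
  obtain ⟨r, hr⟩ := IsPGroup.iff_card.1 (hpQ.to_subgroup N')
  have hN'top : N' ≠ ⊤ := by
    intro h
    refine hN (eq_top_iff.2 fun g _ => ?_)
    have : QuotientGroup.mk' V g ∈ N' := h ▸ Subgroup.mem_top _
    obtain ⟨g', hg', he⟩ := this
    have h2 : g'⁻¹ * g ∈ V := QuotientGroup.eq.1 he
    have h3 := N.mul_mem hg' (hVN h2)
    rwa [mul_inv_cancel_left] at h3
  have hrm : r < m := by
    have h1 : Nat.card N' < Nat.card (CRSemidirect p k hk I ⧸ V) :=
      lt_of_le_of_ne (Subgroup.card_le_card_group N') fun h =>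
        hN'top (Subgroup.eq_top_of_card_eq _ h)
    rw [hr, hm] at h1
    exact (Nat.pow_lt_pow_iff_right hp.one_lt).1 h1
  obtain ⟨m, rfl⟩ : ∃ m', m = m' + 1 := ⟨m - 1, by omega⟩
  -- In a finite `p`-group a proper subgroup lies in one of index `p`, and the latter is normal
  -- because `p` is the smallest prime factor of the order.
  obtain ⟨M, hM, hNM⟩ := Sylow.exists_subgroup_card_pow_prime_le p (m := m)
    (hm ▸ pow_dvd_pow _ (Nat.le_succ m)) N' hr (by omega)
  have hMi : M.index = p := by
    have h := M.card_mul_index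
    rw [hM, hm, pow_succ] at h
    exact Nat.eq_of_mul_eq_mul_left (pow_pos hp.pos m) h
  have hMn : M.Normal := Subgroup.normal_of_index_eq_minFac_card <| by
    rw [hMi, hm, hp.pow_minFac (Nat.succ_ne_zero m)]
  have hcard : Nat.card ((CRSemidirect p k hk I ⧸ V) ⧸ M) = Nat.card (Multiplicative (ZMod p)) := by
    rw [← Subgroup.index, hMi]; simp
  let e : (CRSemidirect p k hk I ⧸ V) ⧸ M ≃* Multiplicative (ZMod p) :=
    mulEquivOfPrimeCardEq (p := p) (hcard.trans (by simp)) (by simp)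
  let ψ := e.toMonoidHom.comp ((QuotientGroup.mk' M).comp (QuotientGroup.mk' V))
  have hψ (g) : ψ g = 1 ↔ QuotientGroup.mk' V g ∈ M := by
    simp [ψ]
  refine ⟨ψ, Subgroup.isOpen_mono (H₁ := V) (fun g hg => ?_) hUo, fun g hg => ?_, fun h => ?_⟩
  · rw [MonoidHom.mem_ker, hψ, QuotientGroup.mk'_apply, (QuotientGroup.eq_one_iff g).2 hg]
    exact M.one_mem
  · rw [MonoidHom.mem_ker, hψ]
    exact hNM ⟨g, hHN hg, rfl⟩
  · have : M = ⊤ := by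
      rw [eq_top_iff]
      intro x _
      obtain ⟨g, rfl⟩ := QuotientGroup.mk'_surjective V x
      rw [← hψ, h, MonoidHom.one_apply]
    rw [this, Subgroup.index_top] at hMi
    exact hp.ne_one hMi.symm

theorem isLocallyConstant_of_isOpen_ker {G C : Type*} [Group G] [TopologicalSpace G]
    [IsTopologicalGroup G] [Group C] (ψ : G →* C) (h : IsOpen (ψ.ker : Set G)) :
    IsLocallyConstant ψ := by
  rw [IsLocallyConstant.iff_exists_open]
  intro g
  refine ⟨(g⁻¹ * ·) ⁻¹' (ψ.ker : Set G), h.preimage (continuous_const_mul _), ?_, fun y hy => ?_⟩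
  · simp
  · rw [Set.mem_preimage, SetLike.mem_coe, MonoidHom.mem_ker, map_mul, map_inv,
      inv_mul_eq_one] at hy
    exact hy.symm

/-- The action is trivial modulo `p`, so every coordinate modulo `p` is a homomorphism on the
semidirect product. -/
theorem padicRed_onePlusPow (z : ℤ_[p]) : padicRed p (onePlusPow p k hk z) = 1 := by
  obtain ⟨t, ht⟩ := (dvd_pow_self (p : ℤ_[p]) (by omega : k ≠ 0)).trans
    (pow_dvd_onePlusPow_sub_one hk z)
  rw [sub_eq_iff_eq_add] at ht
  simp [ht]

/-- A continuous homomorphism to a group of order `p` is a finite linear combination of the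
coordinates. -/
theorem hom_zmod_apply (ψ : CRSemidirect p k hk I →* Multiplicative (ZMod p))
    (hψ : IsOpen (ψ.ker : Set (CRSemidirect p k hk I))) :
    ∃ (S : Finset I) (c : I → ℕ) (d : ℕ), ∀ v z, ψ (semiMk v z) = Multiplicative.ofAdd
        ((∑ i ∈ S, (PadicInt.toZModPow 1 (v i)).val * c i + (PadicInt.toZModPow 1 z).val * d : ℕ) :
          ZMod p) := by
  classical
  let _ : TopologicalSpace (ZMod p) := ⊥
  have : DiscreteTopology (ZMod p) := ⟨rfl⟩
  have hfin := finite_semiGen_notMem ψ.ker hψ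
  set S := hfin.toFinset
  set c : I → ZMod p := fun i => (ψ (semiGen p k hk I (some i))).toAdd
  set d : ZMod p := (ψ (semiGen p k hk I none)).toAdd
  have hred : Continuous (padicRed p) := isLocallyConstant_padicRed.continuous
  -- The combination of coordinates having the values of `ψ` on the generators. `S` suffices, since
  -- `ψ` kills the other `τ_i`; agreement on generators then spreads to the closed equalizer.
  let κ : CRSemidirect p k hk I →* Multiplicative (ZMod p) := MonoidHom.mk'
    (fun g => Multiplicative.ofAdd
      (∑ i ∈ S, padicRed p (g.left.toAdd i) * c i + padicRed p g.right.toAdd * d)) fun g h => by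
    obtain ⟨v, y, rfl⟩ := semiMk_surjective g
    obtain ⟨w, z, rfl⟩ := semiMk_surjective h
    rw [semiMk_mul, ← ofAdd_add]
    congr 1
    simp only [semiMk, toAdd_ofAdd, Pi.add_apply, Pi.smul_apply, smul_eq_mul, map_add, map_mul,
      padicRed_onePlusPow, one_mul, add_mul, Finset.sum_add_distrib]
    ring
  have hκ : Continuous fun g => (κ g).toAdd := by
    refine (continuous_finsetSum _ fun i _ => ?_).add ?_
    · exact (hred.comp ((continuous_apply i).comp continuous_left)).mul continuous_const
    · exact (hred.comp continuous_right).mul continuous_const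
  have hψ' : Continuous fun g => (ψ g).toAdd :=
    ((isLocallyConstant_of_isOpen_ker ψ hψ).comp Multiplicative.toAdd).continuous
  have htop : ψ.eqLocus κ = ⊤ := by
    refine eq_top_of_semiGen_mem ?_ ?_
    · have h := isClosed_eq hψ' hκ
      exact h
    · rintro (_ | i)
      · change _ = _
        simp [κ, semiGen, semiMk, d]
      · change _ = _
        by_cases hi : ψ (semiGen p k hk I (some i)) = 1
        · have hiS : i ∉ S := by simpa [S] using hi
          rw [hi]
          symm
          refine congrArg Multiplicative.ofAdd ?_
          simp only [semiGen, semiMk, toAdd_ofAdd, map_zero, zero_mul, add_zero]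
          refine Finset.sum_eq_zero fun j hj => ?_
          rw [Pi.single_eq_of_ne (by rintro rfl; exact hiS hj), map_zero, zero_mul]
        · have hiS : i ∈ S := by simpa [S] using hi
          symm
          refine (congrArg Multiplicative.ofAdd ?_).trans (ofAdd_toAdd _)
          simp only [semiGen, semiMk, toAdd_ofAdd, map_zero, zero_mul, add_zero]
          rw [Finset.sum_eq_single_of_mem i hiS]
          · simp [c, semiGen, semiMk]
          · intro j _ hj
            rw [Pi.single_eq_of_ne hj, map_zero, zero_mul]
  refine ⟨S, fun i => (c i).val, d.val, fun v z => ?_⟩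
  have h : semiMk v z ∈ ψ.eqLocus κ := htop ▸ Subgroup.mem_top _
  refine (show ψ (semiMk v z) = κ (semiMk v z) from h).trans ?_
  simp [κ, semiMk, -ZMod.natCast_val, natCast_val_toZModPow_one, ZMod.natCast_zmod_val]

end Semidirect

/-! ### The free pro-`p` group: compactness, density of words, universal property -/

section FreeProP

variable {p : ℕ} {X : Type*}

theorem ProPIndex.proj_eq_one {N : ProPIndex p X} {w : FreeGroup X} :
    N.proj w = 1 ↔ w ∈ N.sub := QuotientGroup.eq_one_iff w

theorem ProPIndex.proj_surjective (N : ProPIndex p X) : Function.Surjective N.proj :=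
  QuotientGroup.mk'_surjective N.sub

theorem ProPIndex.exists_pow_eq_one (N : ProPIndex p X) : ∃ n, ∀ q : N.Quot, q ^ p ^ n = 1 := by
  obtain ⟨n, hn⟩ := N.index_eq
  refine ⟨n, fun q => ?_⟩
  rw [← hn]
  exact pow_card_eq_one' (G := FreeGroup X ⧸ N.sub) (x := q)

theorem FreeProP.eq_of_le {N M : ProPIndex p X} (h : N.sub ≤ M.sub) {x y : FreeProP p X}
    (hxy : x.1 N = y.1 N) : x.1 M = y.1 M := by
  rw [← x.2 N M h, ← y.2 N M h, hxy]

theorem FreeProP.continuous_apply (N : ProPIndex p X) :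
    Continuous fun x : FreeProP p X => x.1 N :=
  (_root_.continuous_apply N).comp continuous_subtype_val

theorem FreeProP.exists_word (x : FreeProP p X) (N : ProPIndex p X) :
    ∃ w, (FreeProP.ofWord p w).1 N = x.1 N :=
  N.proj_surjective (x.1 N)

variable [hp : Fact p.Prime]

theorem exists_eq_pow_of_dvd {a n : ℕ} (h : a ∣ p ^ n) : ∃ m, a = p ^ m :=
  let ⟨m, _, hm⟩ := (Nat.dvd_prime_pow hp.out).1 h
  ⟨m, hm⟩

instance ProPIndex.finiteIndex (N : ProPIndex p X) : N.sub.FiniteIndex := by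
  obtain ⟨n, hn⟩ := N.index_eq
  exact ⟨by rw [hn]; exact pow_ne_zero _ hp.out.ne_zero⟩

instance ProPIndex.finite_quot (N : ProPIndex p X) : Finite N.Quot :=
  inferInstanceAs (Finite (FreeGroup X ⧸ N.sub))

/-- The intersection of two members of the index set of the free pro-`p` group. -/
def ProPIndex.inf (N M : ProPIndex p X) : ProPIndex p X where
  sub := N.sub ⊓ M.sub
  normal := inferInstance
  index_eq := by
    refine (IsPGroup.iff_card (G := FreeGroup X ⧸ (N.sub ⊓ M.sub))).1 fun g => ?_
    induction g using QuotientGroup.induction_on with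
    | H g =>
      obtain ⟨a, ha⟩ := N.exists_pow_eq_one
      obtain ⟨b, hb⟩ := M.exists_pow_eq_one
      refine ⟨a + b, ?_⟩
      rw [← QuotientGroup.mk_pow, QuotientGroup.eq_one_iff]
      refine Subgroup.mem_inf.2 ⟨?_, ?_⟩
      · rw [← ProPIndex.proj_eq_one, pow_add, pow_mul, map_pow, map_pow, ha,
          one_pow]
      · rw [← ProPIndex.proj_eq_one, add_comm, pow_add, pow_mul, map_pow, map_pow,
          hb, one_pow]
  cofinite := by
    refine (N.cofinite.union M.cofinite).subset fun x hx => ?_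
    by_contra h
    simp only [Set.mem_union, Set.mem_ofPred_eq, not_or, not_not] at h
    exact hx ⟨h.1, h.2⟩

/-- The join of a member of the index set of the free pro-`p` group with a normal subgroup. -/
def ProPIndex.sup (N : ProPIndex p X) (K : Subgroup (FreeGroup X)) [K.Normal] : ProPIndex p X where
  sub := N.sub ⊔ K
  normal := inferInstance
  index_eq := by
    obtain ⟨n, hn⟩ := N.index_eq
    have h := Subgroup.index_dvd_of_le (le_sup_left : N.sub ≤ N.sub ⊔ K)
    rw [hn] at h
    exact exists_eq_pow_of_dvd h
  cofinite := N.cofinite.subset fun _ hy h => hy (Subgroup.mem_sup_left h)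

instance : Nonempty (ProPIndex p X) :=
  ⟨{ sub := ⊤, normal := inferInstance, index_eq := ⟨0, by simp⟩, cofinite := by simp }⟩

theorem FreeProP.isClosed :
    IsClosed (freeProPSubgroup p X : Set (∀ N : ProPIndex p X, N.Quot)) := by
  have h : (freeProPSubgroup p X : Set (∀ N : ProPIndex p X, N.Quot)) =
      ⋂ (N : ProPIndex p X) (M : ProPIndex p X) (h : N.sub ≤ M.sub),
        {f | N.map M h (f N) = f M} := by
    ext f
    simp only [Set.mem_iInter]
    rfl
  rw [h]
  refine isClosed_iInter fun N => isClosed_iInter fun M => isClosed_iInter fun h => ?_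
  exact isClosed_eq ((continuous_of_discreteTopology).comp (_root_.continuous_apply N))
    (_root_.continuous_apply M)

instance FreeProP.compactSpace : CompactSpace (FreeProP p X) :=
  isCompact_iff_compactSpace.1 FreeProP.isClosed.isCompact

/-- The index set is directed under intersection, so the finitely many coordinates of a basic
neighbourhood are controlled by a single one. -/
theorem FreeProP.exists_subset_of_mem_nhds {x : FreeProP p X} {U : Set (FreeProP p X)}
    (hU : U ∈ 𝓝 x) : ∃ N : ProPIndex p X, ∀ y : FreeProP p X, y.1 N = x.1 N → y ∈ U := by
  classical
  rw [nhds_subtype_eq_comap, Filter.mem_comap] at hU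
  obtain ⟨V, hV, hVU⟩ := hU
  rw [nhds_pi, Filter.mem_pi'] at hV
  obtain ⟨T, W, hW, hWV⟩ := hV
  have hT : ∃ N : ProPIndex p X, ∀ M ∈ T, N.sub ≤ M.sub := by
    clear hWV
    induction T using Finset.induction_on with
    | empty => exact ⟨Classical.arbitrary _, by simp⟩
    | insert M T _ ih =>
      obtain ⟨N, hN⟩ := ih
      refine ⟨M.inf N, fun M' hM' => ?_⟩
      rcases Finset.mem_insert.1 hM' with rfl | h
      · exact inf_le_left
      · exact inf_le_right.trans (hN _ h)
  obtain ⟨N, hN⟩ := hT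
  refine ⟨N, fun y hy => hVU (hWV fun M hM => ?_)⟩
  rw [FreeProP.eq_of_le (hN M hM) hy]
  exact mem_of_mem_nhds (hW M)

theorem FreeProP.denseRange_ofWord : DenseRange (FreeProP.ofWord p (X := X)) := by
  intro x
  rw [mem_closure_iff_nhds]
  intro U hU
  obtain ⟨N, hN⟩ := FreeProP.exists_subset_of_mem_nhds hU
  obtain ⟨w, hw⟩ := FreeProP.exists_word x N
  exact ⟨_, hN _ hw, w, rfl⟩

/-- The universal property of the free pro-`p` group on a set converging to `1`. -/
theorem FreeProP.exists_lift {G : Type*} [Group G] [TopologicalSpace G] [IsTopologicalGroup G]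
    [CompactSpace G] [T2Space G] [TotallyDisconnectedSpace G]
    (hG : ∀ U : Subgroup G, U.Normal → IsOpen (U : Set G) → ∃ n, U.index = p ^ n) (f : X → G)
    (hf : ∀ U : Subgroup G, IsOpen (U : Set G) → {x | f x ∉ U}.Finite) :
    ∃ Φ : FreeProP p X →ₜ* G, ∀ w, Φ (FreeProP.ofWord p w) = FreeGroup.lift f w := by
  -- The lift is obtained as its graph: the closure of the graph of `FreeGroup.lift f` on words.
  set Γ := ((FreeProP.ofWord p).prod (FreeGroup.lift f)).range.topologicalClosure with hΓ
  have hcl : IsClosed (Γ : Set (FreeProP p X × G)) := Subgroup.isClosed_topologicalClosure _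
  have hmem (w : FreeGroup X) : (FreeProP.ofWord p w, FreeGroup.lift f w) ∈ Γ :=
    Subgroup.le_topologicalClosure _ ⟨w, rfl⟩
  have huniq (g : G) (hg : (1, g) ∈ Γ) : g = 1 := by
    by_contra hne
    obtain ⟨U, hU⟩ := ProfiniteGrp.exist_openNormalSubgroup_sub_open_nhds_of_one
      (isOpen_compl_singleton (x := g)) (Ne.symm hne)
    have hUo := U.isOpen
    have hUn : U.toSubgroup.Normal := U.isNormal'
    let N : ProPIndex p X :=
      { sub := U.toSubgroup.comap (FreeGroup.lift f)
        normal := inferInstance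
        index_eq := by
          obtain ⟨n, hn⟩ := hG U.toSubgroup hUn hUo
          rw [Subgroup.index_comap]
          exact exists_eq_pow_of_dvd (hn ▸ Subgroup.relIndex_dvd_index_of_normal _ _)
        cofinite := by
          simpa using hf U.toSubgroup hUo }
    -- On words, triviality in coordinate `N` means that the value lies in `U`. This is a closed
    -- condition, so it passes to `Γ` and excludes `(1, g)` with `g ∉ U`.
    have hsub : (Γ : Set (FreeProP p X × G)) ⊆ {y | y.1.1 N = 1}ᶜ ∪ {y | y.2 ∈ U.toSubgroup} := by
      refine closure_minimal ?_ (IsClosed.union ?_ ?_)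
      · rintro _ ⟨w, rfl⟩
        by_cases hw : w ∈ N.sub
        · exact Or.inr hw
        · exact Or.inl fun h => hw (ProPIndex.proj_eq_one.1 h)
      · rw [isClosed_compl_iff]
        exact (isOpen_discrete {1}).preimage
          ((FreeProP.continuous_apply N).comp continuous_fst)
      · exact (U.toSubgroup.isClosed_of_isOpen hUo).preimage continuous_snd
    rcases hsub hg with h | h
    · exact h rfl
    · exact hU h rfl
  have huniq' (a : FreeProP p X) (b b' : G) (h : (a, b) ∈ Γ) (h' : (a, b') ∈ Γ) : b = b' := by
    have h1 := Γ.mul_mem (Γ.inv_mem h) h'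
    rw [Prod.inv_mk, Prod.mk_mul_mk, inv_mul_cancel] at h1
    exact inv_mul_eq_one.1 (huniq _ h1)
  obtain ⟨Φ, hΦ⟩ := exists_continuousMonoidHom_of_isClosed hcl (fun x hx y hy => Γ.mul_mem hx hy)
    (fun a => by
      have hfst : IsClosed (Prod.fst '' (Γ : Set (FreeProP p X × G))) :=
        isClosedMap_fst_of_compactSpace _ hcl
      have ha : a ∈ Prod.fst '' (Γ : Set (FreeProP p X × G)) := by
        refine FreeProP.denseRange_ofWord.induction_on a hfst fun w => ?_
        exact ⟨_, hmem w, rfl⟩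
      obtain ⟨⟨a', b⟩, hb, rfl⟩ := ha
      exact ⟨b, hb, fun b' hb' => huniq' _ _ _ hb' hb⟩)
  exact ⟨Φ, fun w => huniq' _ _ _ (hΦ _) (hmem w)⟩

end FreeProP

/-! ### Finite products of `p`-adic powers of commuting elements -/

section PiPow

variable {p : ℕ} [Fact p.Prime] {I Q : Type*} [Group Q]

/-- `v ↦ ∏ i ∈ S, t i ^ v i` for commuting elements `t i` with `t i ^ p ^ n = 1`. -/
noncomputable def piPow (S : Finset I) (t : I → Q) (n : ℕ) (hn : ∀ i, t i ^ p ^ n = 1)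
    (hcomm : ∀ i j, Commute (t i) (t j)) : Multiplicative (I → ℤ_[p]) →* Q where
  toFun v := S.noncommProd (fun i => padicPow n (t i) (v.toAdd i))
    fun i _ j _ _ => (hcomm i j).pow_pow _ _
  map_one' := by
    refine (Finset.noncommProd_eq_pow_card _ _ _ 1 fun i _ => padicPow_zero).trans (one_pow _)
  map_mul' v w :=
    (Finset.noncommProd_congr rfl (fun i _ => padicPow_add (hn i) _ _) _).trans
      (Finset.noncommProd_mul_distrib _ _ _ _ fun i _ j _ _ => (hcomm i j).pow_pow _ _)

theorem pairwise_commute_padicPow (S : Finset I) (t : I → Q) (n : ℕ)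
    (hcomm : ∀ i j, Commute (t i) (t j)) (v : I → ℤ_[p]) :
    (S : Set I).Pairwise (Function.onFun Commute fun i => padicPow n (t i) (v i)) :=
  fun i _ j _ _ => (hcomm i j).pow_pow _ _

variable {S : Finset I} {t : I → Q} {n : ℕ} {hn : ∀ i, t i ^ p ^ n = 1}
  {hcomm : ∀ i j, Commute (t i) (t j)}

theorem piPow_apply (v : I → ℤ_[p]) : piPow S t n hn hcomm (Multiplicative.ofAdd v) =
    S.noncommProd (fun i => padicPow n (t i) (v i)) (pairwise_commute_padicPow S t n hcomm v) := rfl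

open Classical in
theorem piPow_single (hS : ∀ i ∉ S, t i = 1) (i : I) :
    piPow S t n hn hcomm (Multiplicative.ofAdd (Pi.single i (1 : ℤ_[p]))) = t i := by
  rw [piPow_apply]
  by_cases hi : i ∈ S
  · refine (Finset.mul_noncommProd_erase S hi _ _).symm.trans ?_
    refine (congrArg _ (Finset.noncommProd_eq_pow_card _ _ _ 1 fun j hj => ?_)).trans ?_
    · rw [Pi.single_eq_of_ne (Finset.ne_of_mem_erase hj), padicPow_zero]
    · rw [Pi.single_eq_same, padicPow_one (hn i), one_pow, mul_one]
  · rw [hS i hi]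
    refine (Finset.noncommProd_eq_pow_card _ _ _ 1 fun j hj => ?_).trans (one_pow _)
    rw [Pi.single_eq_of_ne (by rintro rfl; exact hi hj), padicPow_zero]

theorem piPow_eq_one {v : I → ℤ_[p]} (hv : ∀ i ∈ S, PadicInt.toZModPow n (v i) = 0) :
    piPow S t n hn hcomm (Multiplicative.ofAdd v) = 1 := by
  rw [piPow_apply]
  refine (Finset.noncommProd_eq_pow_card _ _ _ 1 fun i hi => ?_).trans (one_pow _)
  simp [padicPow, hv i hi]

theorem piPow_smul (s : Q) (c : ℤ_[p]) (hs : ∀ i, s * t i * s⁻¹ = padicPow n (t i) c)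
    (v : I → ℤ_[p]) : piPow S t n hn hcomm (Multiplicative.ofAdd (c • v)) =
      s * piPow S t n hn hcomm (Multiplicative.ofAdd v) * s⁻¹ := by
  rw [← MulAut.conj_apply, piPow_apply, piPow_apply, Finset.map_noncommProd]
  refine Finset.noncommProd_congr rfl (fun i _ => ?_) _
  rw [map_padicPow, MulAut.conj_apply, hs, ← padicPow_mul (hn i)]
  rfl

end PiPow

/-! ### The presented group is the semidirect product -/

section Kernel

variable {p k : ℕ} [hp : Fact p.Prime] {hk : 1 ≤ k} {I : Type*}

/-- A quotient of the free group by a normal subgroup of `p`-power index that contains the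
relators is a continuous quotient of the semidirect product. -/
theorem ProPIndex.exists_hom (M : ProPIndex p (Option I)) (hM : crRelators p k I ⊆ M.sub) :
    ∃ θ : CRSemidirect p k hk I →* M.Quot, IsOpen (θ.ker : Set (CRSemidirect p k hk I)) ∧
      ∀ w, θ (FreeGroup.lift (semiGen p k hk I) w) = M.proj w := by
  classical
  obtain ⟨n, hn⟩ := M.exists_pow_eq_one
  set t : I → M.Quot := fun i => M.proj (FreeGroup.of (some i)) with ht
  set s : M.Quot := M.proj (FreeGroup.of none) with hs
  have hcomm (i j : I) : Commute (t i) (t j) := by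
    have h : ⁅tauWord i, tauWord j⁆ ∈ M.sub := hM (Or.inl ⟨i, j, rfl⟩)
    rw [← ProPIndex.proj_eq_one, map_commutatorElement, commutatorElement_eq_one_iff_commute] at h
    exact h
  have hrel (i : I) : s * t i * s⁻¹ = padicPow n (t i) (1 + (p : ℤ_[p]) ^ k) := by
    have h : ⁅sigmaWord I, tauWord i⁆ * (tauWord i ^ p ^ k)⁻¹ ∈ M.sub := hM (Or.inr ⟨i, rfl⟩)
    rw [← ProPIndex.proj_eq_one, map_mul, map_commutatorElement, map_inv, map_pow,
      mul_inv_eq_one, commutatorElement_def] at h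
    have h2 : s * t i * s⁻¹ = t i ^ p ^ k * t i := mul_inv_eq_iff_eq_mul.1 h
    have h3 : (1 + (p : ℤ_[p]) ^ k) = ((p ^ k + 1 : ℕ) : ℤ_[p]) := by push_cast; ring
    rw [h2, h3, padicPow_natCast (hn _), pow_succ]
  -- Only finitely many `t i` are nontrivial, by `M.cofinite`; hence a finite product defines the
  -- map on all of `∏ ℤ_p`.
  set S := (M.cofinite.preimage (Option.some_injective I).injOn).toFinset with hSdef
  have hS (i : I) (hi : i ∉ S) : t i = 1 := by
    rw [ht, ProPIndex.proj_eq_one]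
    simpa [S] using hi
  let fn := piPow (p := p) S t n (fun i => hn _) hcomm
  let fg := padicPowHom (p := p) n s (hn s)
  have hconj (z : ℤ_[p]) (v : I → ℤ_[p]) :
      fn (Multiplicative.ofAdd (onePlusPow p k hk z • v)) =
        padicPow n s z * fn (Multiplicative.ofAdd v) * (padicPow n s z)⁻¹ := by
    refine piPow_smul _ _ (fun i => ?_) v
    -- Both sides are locally constant in `z`, so natural `z` suffice, and there the relation `hrel`
    -- is iterated.
    refine PadicInt.denseRange_natCast.induction_on z ?_ fun m => ?_
    · refine isClosed_eq ?_ ?_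
      · exact ((isLocallyConstant_padicPow n s).comp fun q => q * t i * q⁻¹).continuous
      · exact ((isLocallyConstant_padicPow n (t i)).comp_continuous
          (continuous_onePlusPow hk)).continuous
    · rw [padicPow_natCast (hn s), onePlusPow_natCast]
      induction m with
      | zero => simp [padicPow_one (hn (t i))]
      | succ m ih =>
        rw [pow_succ' (1 + (p : ℤ_[p]) ^ k), padicPow_mul (hn _), ← hrel, ← MulAut.conj_apply s,
          ← map_padicPow, ← ih, MulAut.conj_apply]
        group
  have hcompat : ∀ g, fn.comp (crAction p k hk I g).toMonoidHom =
      (MulAut.conj (fg g)).toMonoidHom.comp fn := fun g => MonoidHom.ext fun v => hconj _ _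
  refine ⟨SemidirectProduct.lift fn fg hcompat, ?_, fun w => ?_⟩
  · refine Subgroup.isOpen_of_mem_nhds _ (g := 1) ?_
    have h1 : ∀ᶠ g : CRSemidirect p k hk I in 𝓝 1,
        ∀ i ∈ S, PadicInt.toZModPow n (g.left.toAdd i) = 0 := by
      rw [Filter.eventually_all_finset]
      intro i _
      have h := ((isLocallyConstant_toZModPow (p := p) n).comp_continuous
        ((continuous_apply i).comp (continuous_left (hk := hk) (k := k)))).isOpen_fiber 0
      exact h.mem_nhds (by simp)
    have h2 : ∀ᶠ g : CRSemidirect p k hk I in 𝓝 1, PadicInt.toZModPow n g.right.toAdd = 0 := by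
      have h := ((isLocallyConstant_toZModPow (p := p) n).comp_continuous
        (continuous_right (I := I) (hk := hk) (k := k))).isOpen_fiber 0
      exact h.mem_nhds (by simp)
    filter_upwards [h1, h2] with g hg1 hg2
    rw [SetLike.mem_coe, MonoidHom.mem_ker]
    change fn (Multiplicative.ofAdd g.left.toAdd) * padicPow n s g.right.toAdd = 1
    rw [piPow_eq_one hg1, padicPow, hg2]
    simp
  · have h : (SemidirectProduct.lift fn fg hcompat).comp (FreeGroup.lift (semiGen p k hk I)) =
        M.proj := by
      refine FreeGroup.ext_hom _ _ ?_
      rintro (_ | i)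
      · rw [MonoidHom.comp_apply, FreeGroup.lift_apply_of]
        change fn 1 * padicPow n s 1 = _
        rw [map_one, one_mul, padicPow_one (hn s)]
      · rw [MonoidHom.comp_apply, FreeGroup.lift_apply_of]
        change fn (Multiplicative.ofAdd (Pi.single i 1)) * padicPow n s 0 = _
        rw [padicPow_zero, mul_one, piPow_single hS]
    exact DFunLike.congr_fun h w

/-- One inclusion checks the relations in the semidirect product. For the other, an element of the
kernel is approximated at each level `N` by a product of conjugates of relators: it is trivial at
the level `M` generated by `N` and the relators, because that quotient factors through the
semidirect product. -/
theorem relatorSubgroup_eq_ker (Φ : FreeProP p (Option I) →ₜ* CRSemidirect p k hk I)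
    (hΦ : ∀ w, Φ (FreeProP.ofWord p w) = FreeGroup.lift (semiGen p k hk I) w) :
    relatorSubgroup p (crRelators p k I) = Φ.toMonoidHom.ker := by
  classical
  refine le_antisymm ?_ fun x hx => ?_
  · refine Subgroup.topologicalClosure_minimal _ (Subgroup.normalClosure_le_normal ?_) ?_
    · rintro _ ⟨r, hr, rfl⟩
      change Φ _ = 1
      rw [hΦ]
      rcases hr with ⟨i, j, rfl⟩ | ⟨i, rfl⟩
      · rw [map_commutatorElement, commutatorElement_eq_one_iff_mul_comm]
        simp only [tauWord, FreeGroup.lift_apply_of, semiGen, semiMk_mul]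
        simp [add_comm]
      · rw [map_mul, map_commutatorElement, map_inv, map_pow, mul_inv_eq_one,
          commutatorElement_def, mul_inv_eq_iff_eq_mul, mul_inv_eq_iff_eq_mul]
        simp only [tauWord, sigmaWord, FreeGroup.lift_apply_of, semiGen, semiMk_mul, semiMk_inl_pow,
          onePlusPow_one]
        rw [semiMk_inj]
        refine ⟨?_, by simp⟩
        ext j
        simp [add_mul, add_comm]
    · exact isClosed_singleton.preimage Φ.continuous_toFun
  · refine mem_closure_iff_nhds.2 fun U hU => ?_
    obtain ⟨N, hN⟩ := FreeProP.exists_subset_of_mem_nhds hU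
    set M := N.sup (Subgroup.normalClosure (crRelators p k I))
    obtain ⟨θ, hθ, hθw⟩ := M.exists_hom (hk := hk)
      (Subgroup.subset_normalClosure.trans (SetLike.coe_subset_coe.2 le_sup_right))
    have hxM : x.1 M = θ (Φ x) := by
      refine FreeProP.denseRange_ofWord.induction_on x ?_ fun w => ?_
      · exact isClosed_eq (FreeProP.continuous_apply M)
          ((isLocallyConstant_of_isOpen_ker θ hθ).continuous.comp Φ.continuous_toFun)
      · rw [hΦ, hθw]; rfl
    have hx1 : Φ x = 1 := hx
    rw [hx1, map_one] at hxM
    obtain ⟨w, hw⟩ := FreeProP.exists_word x N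
    have hwM : w ∈ M.sub := by
      rw [← ProPIndex.proj_eq_one, ← hxM]
      exact FreeProP.eq_of_le (N := N) (M := M) le_sup_left hw
    -- The factor `y` is invisible at level `N`, so `r`, in the normal closure of the relators,
    -- represents `x` there.
    obtain ⟨y, hy, r, hr, rfl⟩ := Subgroup.mem_sup_of_normal_left.1 hwM
    refine ⟨FreeProP.ofWord p r, hN _ ?_, ?_⟩
    · rw [← hw]
      change N.proj r = N.proj (y * r)
      rw [map_mul, ProPIndex.proj_eq_one.2 hy, one_mul]
    · have h : Subgroup.normalClosure (crRelators p k I) ≤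
          (Subgroup.normalClosure (FreeProP.ofWord p '' crRelators p k I)).comap
            (FreeProP.ofWord p) :=
        Subgroup.normalClosure_le_normal fun r hr =>
          Subgroup.subset_normalClosure ⟨r, hr, rfl⟩
      exact h hr

/-- The presented pro-`p` group is the semidirect product. -/
theorem exists_presented_equiv (p k : ℕ) [Fact p.Prime] (hk : 1 ≤ k) (I : Type*) :
    ∃ e : ProPPresented p (crRelators p k I) ≃ₜ* CRSemidirect p k hk I,
      ∀ x, e (ProPPresented.of p _ x) = semiGen p k hk I x := by
  obtain ⟨Φ, hΦ⟩ := FreeProP.exists_lift (p := p) (X := Option I) (G := CRSemidirect p k hk I)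
    (fun U _ hU => exists_index_eq_pow U hU) (semiGen p k hk I) fun U hU => by
      refine (((finite_semiGen_notMem U hU).image some).union (Set.finite_singleton none)).subset ?_
      rintro (_ | i) hx
      · exact Or.inr rfl
      · exact Or.inl ⟨i, hx, rfl⟩
  have hker := relatorSubgroup_eq_ker Φ hΦ
  have hsurj : Function.Surjective Φ := by
    have hcl : IsClosed (Set.range Φ) := (isCompact_range Φ.continuous_toFun).isClosed
    intro g
    refine denseRange_lift_semiGen.induction_on (p := fun g => ∃ a, Φ a = g) g hcl fun w => ?_
    exact ⟨_, hΦ w⟩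
  let ψ := QuotientGroup.lift (relatorSubgroup p (crRelators p k I)) Φ.toMonoidHom hker.le
  refine ⟨continuousMulEquivOfBijective ψ ?_ ⟨?_, ?_⟩, fun x => ?_⟩
  · exact Φ.continuous_toFun.quotient_lift _
  · rw [← MonoidHom.ker_eq_bot_iff, eq_bot_iff]
    intro x hx
    induction x using QuotientGroup.induction_on with
    | H x =>
      have : x ∈ Φ.toMonoidHom.ker := hx
      rw [← hker] at this
      exact (QuotientGroup.eq_one_iff x).2 this
  · intro g
    obtain ⟨x, hx⟩ := hsurj g
    exact ⟨QuotientGroup.mk x, hx⟩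
  · refine (hΦ (FreeGroup.of x)).trans ?_
    rw [FreeGroup.lift_apply_of]

end Kernel

/-! ### The Galois action on a radical system -/

section Galois

/-- A compatible system of `p`-power roots of representatives of a basis of `Fˣ / (Fˣ) ^ p`, whose
first member is a root of unity, and of `p`-power roots of unity, which generates `K` over `F` in
the sense that an automorphism fixing all radicals is trivial. -/
structure RadicalSystem (p k : ℕ) (I F K : Type*) [Field F] [Field K] [Algebra F K] where
  gen : Option I → Fˣ
  root : Option I → ℕ → K
  root_zero : ∀ j, root j 0 = algebraMap F K (gen j)
  root_succ : ∀ j n, root j (n + 1) ^ p = root j n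
  zeta : ℕ → K
  isPrimitiveRoot : ∀ n, IsPrimitiveRoot (zeta n) (p ^ n)
  zeta_succ : ∀ n, zeta (n + 1) ^ p = zeta n
  zeta_add : ∀ n, zeta (k + n) = root none n
  span : ∀ x : Fˣ, ∃ (S : Finset (Option I)) (c : Option I → ℕ) (y : Fˣ),
    x = (∏ j ∈ S, gen j ^ c j) * y ^ p
  indep : ∀ (S : Finset (Option I)) (c : Option I → ℕ) (y : Fˣ),
    ∏ j ∈ S, gen j ^ c j = y ^ p → ∀ j ∈ S, p ∣ c j
  faithful : ∀ s : Gal(K/F),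
    (∀ (x : K) (m : ℕ) (c : Fˣ), x ^ p ^ m = algebraMap F K c → s x = x) → s = 1

theorem pow_prime_pow_add {p : ℕ} {M : Type*} [Monoid M] {u : ℕ → M}
    (hu : ∀ n, u (n + 1) ^ p = u n) (n m : ℕ) : u (n + m) ^ p ^ m = u n := by
  induction m with
  | zero => simp
  | succ m ih => rw [← add_assoc, pow_succ', pow_mul, hu, ih]

theorem isLocallyConstant_galois_apply {F K : Type*} [Field F] [Field K] [Algebra F K]
    [Algebra.IsIntegral F K] (x : K) : IsLocallyConstant fun s : Gal(K/F) => s x := by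
  rw [IsLocallyConstant.iff_exists_open]
  intro s
  have hfin : FiniteDimensional F (IntermediateField.adjoin F {x}) :=
    IntermediateField.adjoin.finiteDimensional (Algebra.IsIntegral.isIntegral x)
  refine ⟨(s⁻¹ * ·) ⁻¹' ((IntermediateField.adjoin F {x}).fixingSubgroup : Set Gal(K/F)),
    (IntermediateField.fixingSubgroup_isOpen _).preimage (continuous_const_mul _), ?_,
    fun t ht => ?_⟩
  · simp
  · have h := (IntermediateField.mem_fixingSubgroup_iff _ _).1 ht x
      (IntermediateField.mem_adjoin_simple_self F x)
    have h2 := congrArg s h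
    rwa [AlgEquiv.mul_apply, ← AlgEquiv.mul_apply, mul_inv_cancel, AlgEquiv.one_apply] at h2

theorem isClosed_setOf_eq_of_isLocallyConstant {X Y : Type*} [TopologicalSpace X] {f g : X → Y}
    (hf : IsLocallyConstant f) (hg : IsLocallyConstant g) : IsClosed {x | f x = g x} := by
  have h := (hf.prodMk hg) (Set.diagonal Y)ᶜ
  rw [Set.preimage_compl, isOpen_compl_iff] at h
  exact h

namespace RadicalSystem

variable {p k : ℕ} {I F K : Type*} [Field F] [Field K] [Algebra F K]
  (R : RadicalSystem p k I F K)

theorem zeta_pow (n : ℕ) : R.zeta n ^ p ^ n = 1 := (R.isPrimitiveRoot n).pow_eq_one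

theorem zeta_zero : R.zeta 0 = 1 := by simpa using R.zeta_pow 0

theorem zeta_eq : R.zeta k = algebraMap F K (R.gen none) := by
  rw [← R.root_zero, ← R.zeta_add, add_zero]

theorem zeta_one_eq (hk : 1 ≤ k) :
    R.zeta 1 = algebraMap F K ((R.gen none ^ p ^ (k - 1) : Fˣ) : F) := by
  have h := pow_prime_pow_add R.zeta_succ 1 (k - 1)
  rw [Nat.add_sub_cancel' hk, R.zeta_eq] at h
  rw [← h]; simp

variable [hp : Fact p.Prime] {hk : 1 ≤ k}

theorem root_ne_zero (j : Option I) (n : ℕ) : R.root j n ≠ 0 := by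
  intro h
  have h1 := pow_prime_pow_add (R.root_succ j) 0 n
  rw [zero_add, h, R.root_zero, zero_pow (pow_ne_zero _ hp.out.ne_zero)] at h1
  exact (R.gen j).ne_zero ((map_eq_zero _).1 h1.symm)

/-- The character is `1` modulo `p^k` because `ζ_k` lies in `F`, so it has a logarithm to base `1 +
p^k`. -/
theorem exists_cyclotomic (h2 : p = 2 → 2 ≤ k) (hk : 1 ≤ k) (s : Gal(K/F)) :
    ∃ z, ∀ n, s (R.zeta n) = padicPow n (R.zeta n) (onePlusPow p k hk z) := by
  obtain ⟨u, hu⟩ := exists_padicPow_eq R.isPrimitiveRoot R.zeta_succ (u := fun n => s (R.zeta n))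
    (by rw [R.zeta_zero, map_one]) (fun n => by rw [← map_pow, R.zeta_succ])
  have hu1 : (p : ℤ_[p]) ^ k ∣ u - 1 := by
    rw [← toZModPow_eq_zero_iff, map_sub, sub_eq_zero]
    have : NeZero (p ^ k) := ⟨pow_ne_zero _ hp.out.ne_zero⟩
    refine ZMod.val_injective _ ((R.isPrimitiveRoot k).pow_inj (ZMod.val_lt _) (ZMod.val_lt _) ?_)
    refine (hu k).symm.trans ?_
    rw [R.zeta_eq, s.commutes, ← R.zeta_eq]
    exact (padicPow_one (R.zeta_pow k)).symm
  obtain ⟨z, rfl⟩ := exists_onePlusPow_eq hk h2 hu1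
  exact ⟨z, hu⟩

theorem exists_kummer (s : Gal(K/F)) (j : Option I) :
    ∃ v : ℤ_[p], ∀ n, s (R.root j n) = padicPow n (R.zeta n) v * R.root j n := by
  obtain ⟨v, hv⟩ := exists_padicPow_eq R.isPrimitiveRoot R.zeta_succ
    (u := fun n => s (R.root j n) / R.root j n)
    (by rw [R.root_zero, s.commutes, ← R.root_zero, div_self (R.root_ne_zero j 0)])
    (fun n => by rw [div_pow, ← map_pow, R.root_succ])
  exact ⟨v, fun n => by rw [← hv, div_mul_cancel₀ _ (R.root_ne_zero j n)]⟩

/-- The relation describing the action of the Galois group on the radicals. -/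
def relation (hk : 1 ≤ k) : Set (Gal(K/F) × CRSemidirect p k hk I) :=
  {x | (∀ n, x.1 (R.zeta n) = padicPow n (R.zeta n) (onePlusPow p k hk x.2.right.toAdd)) ∧
    ∀ i n, x.1 (R.root (some i) n) =
      padicPow n (R.zeta n) (x.2.left.toAdd i) * R.root (some i) n}

/-- Applying `s` to `ζ^w` multiplies the exponent `w` by the character of `s`: this twist is the
semidirect action. -/
theorem relation_mul {x y : Gal(K/F) × CRSemidirect p k hk I} (hx : x ∈ R.relation hk)
    (hy : y ∈ R.relation hk) : x * y ∈ R.relation hk := by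
  obtain ⟨s, g⟩ := x
  obtain ⟨t, h⟩ := y
  obtain ⟨v, a, rfl⟩ := semiMk_surjective g
  obtain ⟨w, b, rfl⟩ := semiMk_surjective h
  obtain ⟨hx1, hx2⟩ := hx
  obtain ⟨hy1, hy2⟩ := hy
  simp only [semiMk, toAdd_ofAdd] at hx1 hx2 hy1 hy2
  rw [Prod.mk_mul_mk, semiMk_mul]
  constructor
  · intro n
    simp only [semiMk, toAdd_ofAdd, AlgEquiv.mul_apply]
    rw [hy1, map_padicPow, hx1, ← padicPow_mul (R.zeta_pow n), AddChar.map_add_eq_mul]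
  · intro i n
    simp only [semiMk, toAdd_ofAdd, AlgEquiv.mul_apply, Pi.add_apply, Pi.smul_apply, smul_eq_mul]
    rw [hy2, map_mul, map_padicPow, hx1, ← padicPow_mul (R.zeta_pow n), hx2, ← mul_assoc,
      padicPow_add (R.zeta_pow n), mul_comm (padicPow n _ (v i))]

theorem isClosed_relation [Algebra.IsIntegral F K] : IsClosed (R.relation hk) := by
  have h : R.relation hk =
      (⋂ n, {x | x.1 (R.zeta n) = padicPow n (R.zeta n) (onePlusPow p k hk x.2.right.toAdd)}) ∩
      ⋂ i, ⋂ n, {x | x.1 (R.root (some i) n) =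
        padicPow n (R.zeta n) (x.2.left.toAdd i) * R.root (some i) n} := by
    ext x
    simp only [Set.mem_inter_iff, Set.mem_iInter]
    rfl
  rw [h]
  refine IsClosed.inter (isClosed_iInter fun n => ?_)
    (isClosed_iInter fun i => isClosed_iInter fun n => ?_)
  · refine isClosed_setOf_eq_of_isLocallyConstant
      ((isLocallyConstant_galois_apply _).comp_continuous continuous_fst) ?_
    exact (isLocallyConstant_padicPow n (R.zeta n)).comp_continuous
      ((continuous_onePlusPow hk).comp (continuous_right.comp continuous_snd))
  · refine isClosed_setOf_eq_of_isLocallyConstant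
      ((isLocallyConstant_galois_apply _).comp_continuous continuous_fst) ?_
    exact ((isLocallyConstant_padicPow n (R.zeta n)).comp (· * R.root (some i) n)).comp_continuous
      ((continuous_apply i).comp (continuous_left.comp continuous_snd))

theorem existsUnique_relation (h2 : p = 2 → 2 ≤ k) (hk : 1 ≤ k) (s : Gal(K/F)) :
    ∃! g, (s, g) ∈ R.relation hk := by
  obtain ⟨z, hz⟩ := R.exists_cyclotomic h2 hk s
  choose v hv using fun i => R.exists_kummer s (some i)
  refine ⟨semiMk v z, ⟨hz, hv⟩, fun g hg => ?_⟩
  obtain ⟨w, y, rfl⟩ := semiMk_surjective g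
  rw [semiMk_inj]
  constructor
  · funext i
    refine padicPow_injective R.isPrimitiveRoot fun n => ?_
    exact mul_right_cancel₀ (R.root_ne_zero (some i) n) ((hg.2 i n).symm.trans (hv i n))
  · refine onePlusPow_injective hk (padicPow_injective R.isPrimitiveRoot fun n => ?_)
    exact (hg.1 n).symm.trans (hz n)

/-- Descent on `m`: writing `c` as a product of basis elements times `y^p`, dividing `x` by the
matching product `δ` of fixed roots leaves a `p^m`-th root of `y` times a `p`-th root of unity, and
the latter lies in `F`. -/
theorem eq_one_of_relation_one (hk : 1 ≤ k) {s : Gal(K/F)} (hs : (s, 1) ∈ R.relation hk) :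
    s = 1 := by
  have hzeta (n : ℕ) : s (R.zeta n) = R.zeta n := by
    refine (hs.1 n).trans ?_
    change padicPow n (R.zeta n) (onePlusPow p k hk 0) = _
    rw [AddChar.map_zero_eq_one, padicPow_one (R.zeta_pow n)]
  have hroot (j : Option I) (n : ℕ) : s (R.root j n) = R.root j n := by
    cases j with
    | none => rw [← R.zeta_add, hzeta]
    | some i =>
      refine (hs.2 i n).trans ?_
      change padicPow n (R.zeta n) 0 * _ = _
      rw [padicPow_zero, one_mul]
  refine R.faithful s fun x m => ?_
  induction m generalizing x with
  | zero =>
    intro c hx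
    rw [pow_zero, pow_one] at hx
    rw [hx, s.commutes]
  | succ m ih =>
    intro c hx
    obtain ⟨S, e, y, rfl⟩ := R.span c
    set δ : K := ∏ j ∈ S, R.root j (m + 1) ^ e j with hδ
    have hδ0 : δ ≠ 0 := Finset.prod_ne_zero_iff.2 fun j _ => pow_ne_zero _ (R.root_ne_zero j _)
    have hsδ : s δ = δ := by
      rw [hδ, map_prod]
      exact Finset.prod_congr rfl fun j _ => by rw [map_pow, hroot]
    have hδp : δ ^ p ^ (m + 1) = algebraMap F K ((∏ j ∈ S, R.gen j ^ e j : Fˣ) : F) := by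
      rw [hδ, ← Finset.prod_pow]
      simp only [Units.coe_prod, Units.val_pow_eq_pow_val, map_prod]
      refine Finset.prod_congr rfl fun j _ => ?_
      have h := pow_prime_pow_add (R.root_succ j) 0 (m + 1)
      rw [zero_add] at h
      rw [← pow_mul, mul_comm, pow_mul, h, R.root_zero, map_pow]
    have hy0 : algebraMap F K y ≠ 0 := (map_ne_zero _).2 y.ne_zero
    have h1 : ((x / δ) ^ p ^ m / algebraMap F K y) ^ p = 1 := by
      rw [div_pow, ← pow_mul, ← pow_succ, div_pow, hx, hδp]
      rw [Units.val_mul, Units.val_pow_eq_pow_val, map_mul, map_pow]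
      have : algebraMap F K ((∏ j ∈ S, R.gen j ^ e j : Fˣ) : F) ≠ 0 :=
        (map_ne_zero _).2 (Units.ne_zero _)
      field_simp
    have h3 : IsPrimitiveRoot (R.zeta 1) p := by simpa using R.isPrimitiveRoot 1
    have : NeZero p := ⟨hp.out.ne_zero⟩
    obtain ⟨i, -, hi⟩ := h3.eq_pow_of_pow_eq_one h1
    rw [eq_div_iff hy0, R.zeta_one_eq hk, ← map_pow, ← map_mul] at hi
    have h4 := ih (x / δ) ((R.gen none ^ p ^ (k - 1)) ^ i * y) (by
      rw [← hi]
      simp only [Units.val_mul, Units.val_pow_eq_pow_val])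
    rw [map_div₀, hsδ, div_left_inj' hδ0] at h4
    exact h4

/-- Modulo `p^(k+1)` one has `(1 + p^k)^z = 1 + p^k z`. Hence `z` modulo `p` is the Kummer
coordinate of the basis element `ζ_k`, on the same footing as the `v_i`. -/
theorem padicPow_zeta_succ (hk : 1 ≤ k) (z : ℤ_[p]) :
    padicPow (k + 1) (R.zeta (k + 1)) (onePlusPow p k hk z) =
      padicPow 1 (R.zeta 1) z * R.zeta (k + 1) := by
  refine PadicInt.denseRange_natCast.induction_on z ?_ fun n => ?_
  · refine isClosed_setOf_eq_of_isLocallyConstant ?_ ?_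
    · exact (isLocallyConstant_padicPow _ _).comp_continuous (continuous_onePlusPow hk)
    · exact (isLocallyConstant_padicPow _ _).comp (· * R.zeta (k + 1))
  · rw [onePlusPow_natCast, padicPow_natCast (R.zeta_pow 1)]
    induction n with
    | zero => simp [padicPow_one (R.zeta_pow (k + 1))]
    | succ n ih =>
      have h1 : R.zeta (k + 1) ^ p ^ k = R.zeta 1 := by
        rw [add_comm]; exact pow_prime_pow_add R.zeta_succ 1 k
      have h2 : R.zeta 1 ^ p ^ k = 1 := by
        obtain ⟨m, rfl⟩ := Nat.exists_eq_add_of_le hk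
        rw [pow_add, pow_mul, R.zeta_pow, one_pow]
      have h3 : (1 + (p : ℤ_[p]) ^ k) = ((1 + p ^ k : ℕ) : ℤ_[p]) := by push_cast; rfl
      rw [pow_succ, padicPow_mul (R.zeta_pow _), ih, h3, padicPow_natCast]
      · rw [pow_add, pow_one, mul_pow, h1, ← pow_mul, mul_comm n, pow_mul, h2, one_pow, one_mul,
          pow_succ]
        ring
      · rw [mul_pow, R.zeta_pow, mul_one, ← pow_mul, mul_comm, pow_mul, add_comm, pow_add, pow_mul,
          R.zeta_pow, one_pow, one_pow]

/-- If the image were proper, a nontrivial `ψ` of order `p` would kill it. Its coefficients form a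
product of `p`-th roots of basis elements fixed by the Galois group, hence in `F`; independence
modulo `p`-th powers makes all coefficients divisible by `p`, so `ψ` is trivial. -/
theorem surjective_of_relation [IsGalois F K] (hk : 1 ≤ k)
    (φ : Gal(K/F) →ₜ* CRSemidirect p k hk I) (hφ : ∀ s, (s, φ s) ∈ R.relation hk) :
    Function.Surjective φ := by
  classical
  have hcl : IsClosed ((φ.toMonoidHom.range : Subgroup _) : Set (CRSemidirect p k hk I)) :=
    (isCompact_range φ.continuous_toFun).isClosed
  by_contra hns
  have hne : φ.toMonoidHom.range ≠ ⊤ := fun h => hns (MonoidHom.range_eq_top.1 h)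
  obtain ⟨ψ, hψo, hψ, hψ1⟩ := exists_hom_of_closed_ne_top hcl hne
  obtain ⟨S, c, d, hSc⟩ := hom_zmod_apply ψ hψo
  let e : Option I → ℕ := fun j => j.elim d c
  set T := Finset.insertNone S with hT
  have hfix : ∀ s : Gal(K/F), s (∏ j ∈ T, R.root j 1 ^ e j) = ∏ j ∈ T, R.root j 1 ^ e j := by
    intro s
    obtain ⟨v, z, hvz⟩ := semiMk_surjective (φ s)
    have h1 := hSc v z
    have h0 : ψ (φ s) = 1 := hψ ⟨s, rfl⟩
    rw [← hvz, h0] at h1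
    have hrel := hφ s
    rw [hvz] at hrel
    have h2 := (ZMod.natCast_eq_zero_iff _ _).1 (Multiplicative.ofAdd.injective h1).symm
    rw [hT, Finset.prod_insertNone, map_mul, map_prod]
    have h3 : s (R.root none 1 ^ e none) =
        R.zeta 1 ^ ((PadicInt.toZModPow 1 z).val * d) * R.root none 1 ^ e none := by
      rw [map_pow, ← R.zeta_add, hrel.1]
      change padicPow _ _ (onePlusPow p k hk z) ^ d = _
      rw [R.padicPow_zeta_succ hk, mul_pow, padicPow, ← pow_mul]
      rfl
    have h4 (i : I) : s (R.root (some i) 1 ^ e (some i)) =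
        R.zeta 1 ^ ((PadicInt.toZModPow 1 (v i)).val * c i) * R.root (some i) 1 ^ e (some i) := by
      rw [map_pow, hrel.2, mul_pow, padicPow, ← pow_mul]
      rfl
    simp only [h3, h4, Finset.prod_mul_distrib, Finset.prod_pow_eq_pow_sum]
    rw [mul_mul_mul_comm, ← pow_add, add_comm]
    obtain ⟨r, hr⟩ := h2
    have h5 := R.zeta_pow 1
    rw [pow_one] at h5
    rw [hr, pow_mul, h5, one_pow, one_mul]
  obtain ⟨b, hb⟩ := (InfiniteGalois.mem_range_algebraMap_iff_fixed _).2 hfix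
  have hb0 : b ≠ 0 := by
    rintro rfl
    rw [map_zero] at hb
    exact Finset.prod_ne_zero_iff.2 (fun j _ => pow_ne_zero (e j) (R.root_ne_zero j 1)) hb.symm
  have hdvd := R.indep T e (Units.mk0 b hb0) (by
    ext
    apply (algebraMap F K).injective
    rw [Units.val_pow_eq_pow_val, map_pow, Units.val_mk0, hb, ← Finset.prod_pow]
    simp only [Units.coe_prod, Units.val_pow_eq_pow_val, map_prod]
    refine Finset.prod_congr rfl fun j _ => ?_
    rw [map_pow, ← R.root_zero, ← R.root_succ, ← pow_mul, ← pow_mul, mul_comm])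
  refine hψ1 (MonoidHom.ext fun g => ?_)
  obtain ⟨v, z, rfl⟩ := semiMk_surjective g
  rw [hSc, MonoidHom.one_apply, ofAdd_eq_one, ZMod.natCast_eq_zero_iff]
  refine dvd_add (Finset.dvd_sum fun i hi => ?_) ?_
  · exact (hdvd (some i) (by simpa [hT] using hi)).mul_left _
  · exact (hdvd none (by simp [hT])).mul_left _

/-- The Galois group of a field generated by a radical system is the semidirect product. -/
theorem nonempty_galois_equiv [IsGalois F K] (R : RadicalSystem p k I F K)
    (h2 : p = 2 → 2 ≤ k) (hk : 1 ≤ k) :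
    Nonempty (Gal(K/F) ≃ₜ* CRSemidirect p k hk I) := by
  obtain ⟨φ, hφ⟩ := exists_continuousMonoidHom_of_isClosed (R.isClosed_relation (hk := hk))
    (fun x hx y hy => R.relation_mul hx hy) (R.existsUnique_relation h2 hk)
  refine ⟨continuousMulEquivOfBijective φ.toMonoidHom φ.continuous_toFun ⟨?_, ?_⟩⟩
  · rw [← MonoidHom.ker_eq_bot_iff, eq_bot_iff]
    intro s hs
    have h := hφ s
    rw [show φ s = 1 from hs] at h
    exact R.eq_one_of_relation_one hk h
  · exact R.surjective_of_relation hk φ hφ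

end RadicalSystem

end Galois

/-! ### Radicals and root sequences in `CR(F)` -/

section CR

variable {F : Type*} [Field F] {p : ℕ}

theorem radicalExt_le_CR (a : Fˣ) {m : ℕ} (hm : 1 ≤ m) : radicalExt F p a m ≤ CR F p :=
  le_iSup_of_le a (le_iSup_of_le m (le_iSup_of_le hm le_rfl))

theorem mem_CR {x : SeparableClosure F} {m : ℕ} {c : Fˣ}
    (hx : x ^ p ^ m = algebraMap F (SeparableClosure F) c) : x ∈ CR F p := by
  -- Passing to `c ^ p` and `m + 1` covers `m = 0`, since the compositum requires exponents at least
  -- `1`.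
  refine radicalExt_le_CR (c ^ p) (Nat.le_add_left 1 m) ?_
  refine IntermediateField.subset_adjoin _ _ (Or.inl ?_)
  change x ^ p ^ (m + 1) = _
  rw [pow_succ, pow_mul, hx, Units.val_pow_eq_pow_val, map_pow]

/-- `CR(F)` is generated by the `p`-power roots of elements of `Fˣ`. -/
theorem CR_le {E : IntermediateField F (SeparableClosure F)}
    (hE : ∀ (x : SeparableClosure F) (m : ℕ) (c : Fˣ),
      x ^ p ^ m = algebraMap F (SeparableClosure F) c → x ∈ E) : CR F p ≤ E := by
  refine iSup_le fun a => iSup_le fun m => iSup_le fun _ => ?_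
  refine IntermediateField.adjoin_le_iff.2 ?_
  rintro x (hx | hx)
  · exact hE x m a hx
  · exact hE x m 1 (by rw [Units.val_one, map_one]; exact hx)

theorem isGalois_CR (F : Type*) [Field F] (p : ℕ) : IsGalois F (CR F p) := by
  have hn : Normal F (CR F p) := by
    rw [IntermediateField.normal_iff_forall_map_le]
    intro σ
    rw [IntermediateField.map_le_iff_le_comap]
    refine CR_le fun x m c hx => ?_
    refine mem_CR (p := p) (m := m) (c := c) ?_
    change σ x ^ p ^ m = _
    rw [← map_pow, hx, σ.commutes]
  exact ⟨⟩

/-- An automorphism of `CR(F)` fixing all `p`-power roots of elements of `Fˣ` is trivial. -/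
theorem galois_eq_one {s : Gal(CR F p/F)}
    (hs : ∀ (x : CR F p) (m : ℕ) (c : Fˣ), x ^ p ^ m = algebraMap F (CR F p) c → s x = x) :
    s = 1 := by
  let E := IntermediateField.fixedField (Subgroup.zpowers s)
  have hfix {x : CR F p} : x ∈ E ↔ s x = x := by
    rw [IntermediateField.mem_fixedField_iff]
    refine ⟨fun h => h s (Subgroup.mem_zpowers s), fun h f hf => ?_⟩
    have hle : Subgroup.zpowers s ≤ MulAction.stabilizer Gal(CR F p/F) x :=
      (Subgroup.zpowers_le).2 h
    exact hle hf
  have hle : CR F p ≤ IntermediateField.lift E := CR_le fun x m c hx => by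
    have hmem := mem_CR hx
    exact (IntermediateField.mem_lift ⟨x, hmem⟩).2 (hfix.2 (hs ⟨x, hmem⟩ m c (Subtype.ext hx)))
  exact AlgEquiv.ext fun x => hfix.1 ((IntermediateField.mem_lift x).1 (hle x.2))

theorem exists_prime_root (hp : (p : F) ≠ 0) {x : CR F p} {m : ℕ} {c : Fˣ}
    (hx : x ^ p ^ m = algebraMap F (CR F p) c) : ∃ y : CR F p, y ^ p = x := by
  have : NeZero (p : SeparableClosure F) :=
    ⟨by rw [← map_natCast (algebraMap F (SeparableClosure F))]; exact (map_ne_zero _).2 hp⟩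
  obtain ⟨y, hy⟩ := IsSepClosed.exists_pow_nat_eq (x : SeparableClosure F) p
  have hx' := congrArg (algebraMap (CR F p) (SeparableClosure F)) hx
  rw [map_pow, ← IsScalarTower.algebraMap_apply] at hx'
  refine ⟨⟨y, mem_CR (m := m + 1) (c := c) ?_⟩, Subtype.ext hy⟩
  rw [pow_succ', pow_mul, hy]
  exact hx'

/-- Compatible systems of `p`-power roots exist in `CR(F)`. -/
theorem exists_root_sequence (hp : (p : F) ≠ 0) {x : CR F p} {m : ℕ} {c : Fˣ}
    (hx : x ^ p ^ m = algebraMap F (CR F p) c) :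
    ∃ u : ℕ → CR F p, u 0 = x ∧ ∀ n, u (n + 1) ^ p = u n := by
  -- The subtype records that each root is again a radical over `F`, so that the choice can be
  -- iterated.
  have hstep : ∀ y : {y : CR F p // ∃ (m : ℕ) (c : Fˣ), y ^ p ^ m = algebraMap F (CR F p) c},
      ∃ z : {y : CR F p // ∃ (m : ℕ) (c : Fˣ), y ^ p ^ m = algebraMap F (CR F p) c},
        z.1 ^ p = y.1 := by
    rintro ⟨y, m, c, hy⟩
    obtain ⟨z, hz⟩ := exists_prime_root hp hy
    exact ⟨⟨z, m + 1, c, by rw [pow_succ', pow_mul, hz, hy]⟩, hz⟩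
  choose f hf using hstep
  refine ⟨fun n => (Nat.rec ⟨x, m, c, hx⟩ (fun _ y => f y) n : {y : CR F p // _}).1, rfl,
    fun n => hf _⟩

/-- The exponent `n + 1` is essential: `x ^ p = 1` alone does not make `x` a primitive `p`-th root
of unity. -/
theorem isPrimitiveRoot_of_pow_prime {M : Type*} [CommMonoid M] [Fact p.Prime] {x : M} {n : ℕ}
    (h : IsPrimitiveRoot (x ^ p) (p ^ (n + 1))) : IsPrimitiveRoot x (p ^ (n + 2)) := by
  rw [IsPrimitiveRoot.iff_orderOf]
  refine orderOf_eq_prime_pow (n := n + 1) ?_ ?_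
  · rw [pow_succ', pow_mul]
    exact h.pow_ne_one_of_pos_of_lt (pow_ne_zero _ (Fact.out : p.Prime).ne_zero)
      (Nat.pow_lt_pow_right (Fact.out : p.Prime).one_lt (Nat.lt_succ_self n))
  · rw [pow_succ', pow_mul]
    exact h.pow_eq_one

theorem exists_zeta_sequence [Fact p.Prime] (hp : (p : F) ≠ 0) {ξ : F}
    (hξ : IsPrimitiveRoot ξ p) :
    ∃ u : ℕ → CR F p, (∀ n, IsPrimitiveRoot (u n) (p ^ n)) ∧ ∀ n, u (n + 1) ^ p = u n := by
  have hξ0 : ξ ≠ 0 := hξ.ne_zero (Fact.out : p.Prime).ne_zero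
  obtain ⟨u, hu0, hu⟩ := exists_root_sequence hp (x := algebraMap F (CR F p) ξ) (m := 0)
    (c := Units.mk0 ξ hξ0) (by simp)
  have hprim (n : ℕ) : IsPrimitiveRoot (u n) (p ^ (n + 1)) := by
    induction n with
    | zero =>
      rw [hu0, zero_add, pow_one]
      exact hξ.map_of_injective (algebraMap F (CR F p)).injective
    | succ n ih =>
      rw [← hu] at ih
      exact isPrimitiveRoot_of_pow_prime ih
  -- The sequence `u` starts at a primitive `p`-th root of unity, so `1` is prepended to shift the
  -- index.
  refine ⟨fun n => n.casesOn 1 u, fun n => ?_, fun n => ?_⟩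
  · cases n with
    | zero => rw [pow_zero]; exact IsPrimitiveRoot.one
    | succ n => exact hprim n
  · cases n with
    | zero => simpa using (hprim 0).pow_eq_one
    | succ n => exact hu n

end CR

/-! ### Bases of `Fˣ/(Fˣ)^p` in multiplicative terms -/

section ModPowers

variable {F : Type*} [Field F] {p : ℕ}

theorem mkQ_eq_zero_iff (x : Fˣ) :
    ModN.mkQ p (Additive.ofMul x) = 0 ↔ ∃ y : Fˣ, x = y ^ p := by
  refine (Submodule.Quotient.mk_eq_zero
    (LinearMap.range (LinearMap.lsmul ℤ (Additive Fˣ) (p : ℤ)))).trans ?_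
  rw [LinearMap.mem_range]
  constructor
  · rintro ⟨y, hy⟩
    refine ⟨y.toMul, ?_⟩
    have h := congrArg Additive.toMul hy
    simpa using h.symm
  · rintro ⟨y, rfl⟩
    exact ⟨Additive.ofMul y, by simp⟩

theorem mkQ_surjective (x : ModN (Additive Fˣ) p) :
    ∃ y : Fˣ, ModN.mkQ p (Additive.ofMul y) = x := by
  obtain ⟨y, hy⟩ := Submodule.mkQ_surjective _ x
  exact ⟨y.toMul, hy⟩

theorem mkQ_prod {J : Type*} (S : Finset J) (g : J → Fˣ) (c : J → ℕ) :
    ModN.mkQ p (Additive.ofMul (∏ j ∈ S, g j ^ c j)) =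
      ∑ j ∈ S, (c j : ZMod p) • ModN.mkQ p (Additive.ofMul (g j)) := by
  rw [ofMul_prod, map_sum]
  refine Finset.sum_congr rfl fun j _ => ?_
  rw [ofMul_pow, map_nsmul, Nat.cast_smul_eq_nsmul]

variable [Fact p.Prime] {J : Type*} {g : J → Fˣ}

theorem exists_prod_mul_pow (b : Module.Basis J (ZMod p) (ModN (Additive Fˣ) p))
    (hg : ∀ j, b j = ModN.mkQ p (Additive.ofMul (g j))) (x : Fˣ) :
    ∃ (S : Finset J) (c : J → ℕ) (y : Fˣ),
    x = (∏ j ∈ S, g j ^ c j) * y ^ p := by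
  set r := b.repr (ModN.mkQ p (Additive.ofMul x)) with hr
  refine ⟨r.support, fun j => (r j).val, ?_⟩
  have h : ModN.mkQ p (Additive.ofMul (x * (∏ j ∈ r.support, g j ^ (r j).val)⁻¹)) = 0 := by
    rw [ofMul_mul, ofMul_inv, map_add, map_neg, mkQ_prod, add_neg_eq_zero]
    conv_lhs => rw [← b.linearCombination_repr (ModN.mkQ p (Additive.ofMul x)),
      Finsupp.linearCombination_apply, Finsupp.sum]
    refine Finset.sum_congr rfl fun j _ => ?_
    rw [ZMod.natCast_zmod_val, hg]
  obtain ⟨y, hy⟩ := (mkQ_eq_zero_iff _).1 h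
  exact ⟨y, by rw [← hy]; rw [mul_comm, inv_mul_cancel_right]⟩

theorem dvd_of_prod_eq_pow (b : Module.Basis J (ZMod p) (ModN (Additive Fˣ) p))
    (hg : ∀ j, b j = ModN.mkQ p (Additive.ofMul (g j)))
    (S : Finset J) (c : J → ℕ) (y : Fˣ)
    (h : ∏ j ∈ S, g j ^ c j = y ^ p) : ∀ j ∈ S, p ∣ c j := by
  have h1 := (mkQ_eq_zero_iff _).2 ⟨y, h⟩
  rw [mkQ_prod] at h1
  simp only [← hg] at h1
  intro j hj
  rw [← ZMod.natCast_eq_zero_iff]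
  exact linearIndependent_iff'.1 b.linearIndependent S _ h1 j hj

end ModPowers

/-! ### Construction of the radical system and conclusion -/

theorem exists_basis_option {R : Type*} {M I : Type u} [Field R] [AddCommGroup M] [Module R M]
    {x : M} (hx : x ≠ 0) (hI : Cardinal.mk I + 1 = Module.rank R M) :
    ∃ b : Module.Basis (Option I) R M, b none = x := by
  classical
  have hli : LinearIndepOn R id {x} := LinearIndepOn.singleton hx
  let b := Module.Basis.extend hli
  let i₀ : hli.extend (Set.subset_univ _) := ⟨x, hli.subset_extend _ (Set.mem_singleton x)⟩
  rw [← b.mk_eq_rank'', ← Cardinal.mk_option] at hI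
  obtain ⟨e⟩ := Cardinal.eq.1 hI.symm
  -- The cardinality of `I` fixes the index set only up to bijection; the swap moves the index of
  -- `x` to `none`.
  refine ⟨b.reindex (e.trans (Equiv.swap (e i₀) none)), ?_⟩
  rw [Module.Basis.reindex_apply]
  simp [b, i₀, Module.Basis.extend_apply_self]

theorem not_isPow_of_isPrimitiveRoot {F : Type*} [Field F] {p k : ℕ} [Fact p.Prime] (hk : 1 ≤ k)
    (hnot : ¬ ∃ ζ : F, IsPrimitiveRoot ζ (p ^ (k + 1))) {z : Fˣ}
    (hz : IsPrimitiveRoot (z : F) (p ^ k)) : ¬ ∃ y : Fˣ, z = y ^ p := by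
  rintro ⟨y, rfl⟩
  obtain ⟨m, rfl⟩ := Nat.exists_eq_add_of_le' hk
  exact hnot ⟨y, isPrimitiveRoot_of_pow_prime (by simpa using hz)⟩

/-- In characteristic `p`, `ζ^(p^k) - 1 = (ζ - 1)^(p^k)`, so `1` is the only root of unity of
`p`-power order. -/
theorem natCast_ne_zero_of_isPrimitiveRoot {F : Type*} [Field F] {p k : ℕ} [hp : Fact p.Prime]
    (hk : 1 ≤ k) {ζ : F} (hζ : IsPrimitiveRoot ζ (p ^ k)) : (p : F) ≠ 0 := by
  intro h
  have : CharP F p := (CharP.charP_iff_prime_eq_zero hp.out).2 h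
  have h1 : ζ = 1 := by
    have h2 := hζ.pow_eq_one
    rw [← sub_eq_zero, ← one_pow (p ^ k), ← sub_pow_char_pow] at h2
    exact sub_eq_zero.1 (pow_eq_zero_iff (pow_ne_zero _ hp.out.ne_zero) |>.1 h2)
  rw [h1] at hζ
  exact (Nat.one_lt_pow (by omega) hp.out.one_lt).ne' (hζ.unique IsPrimitiveRoot.one)

/-- `CR(F)` is generated by a radical system indexed by any set of the right cardinality. -/
theorem nonempty_radicalSystem {F : Type u} [Field F] {p k : ℕ} [hp : Fact p.Prime] (hk : 1 ≤ k)
    (hmem : ∃ ζ : F, IsPrimitiveRoot ζ (p ^ k))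
    (hnot : ¬ ∃ ζ : F, IsPrimitiveRoot ζ (p ^ (k + 1))) {I : Type u}
    (hI : Cardinal.mk I + 1 = Module.rank (ZMod p) (ModN (Additive Fˣ) p)) :
    Nonempty (RadicalSystem p k I F (CR F p)) := by
  obtain ⟨ξ, hξ⟩ := hmem
  have hpF := natCast_ne_zero_of_isPrimitiveRoot hk hξ
  have hpk : p ^ k ≠ 0 := pow_ne_zero _ hp.out.ne_zero
  have hξ1 : IsPrimitiveRoot (ξ ^ p ^ (k - 1)) p :=
    hξ.pow hpk.bot_lt (by rw [← pow_succ, Nat.sub_add_cancel hk])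
  obtain ⟨u, hprim, hu⟩ := exists_zeta_sequence hpF hξ1
  have : NeZero (p ^ k) := ⟨hpk⟩
  -- The member `u k` of the chosen sequence need not be `ξ`, but it is a power of `ξ` and so lies
  -- in `F`. It serves as the basis element `none`, which makes its roots the later members of `u`.
  obtain ⟨j, -, hj⟩ := (hξ.map_of_injective (algebraMap F (CR F p)).injective).eq_pow_of_pow_eq_one
    (hprim k).pow_eq_one
  rw [← map_pow] at hj
  have hz0 : ξ ^ j ≠ 0 := pow_ne_zero _ (hξ.ne_zero hpk)
  set z : Fˣ := Units.mk0 _ hz0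
  have hz : IsPrimitiveRoot (z : F) (p ^ k) := by
    refine IsPrimitiveRoot.of_map_of_injective (f := algebraMap F (CR F p)) ?_
      (algebraMap F (CR F p)).injective
    rw [Units.val_mk0, hj]
    exact hprim k
  obtain ⟨b, hb⟩ := exists_basis_option
    (fun h => not_isPow_of_isPrimitiveRoot hk hnot hz ((mkQ_eq_zero_iff z).1 h)) hI
  choose a ha using fun i : I => mkQ_surjective (b (some i))
  choose w hw0 hw using fun i : I => exists_root_sequence hpF (x := algebraMap F (CR F p) (a i))
    (m := 0) (c := a i) (by simp)
  let g : Option I → Fˣ := fun j => j.elim z a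
  have hg (j : Option I) : b j = ModN.mkQ p (Additive.ofMul (g j)) := by
    cases j with
    | none => exact hb
    | some i => exact (ha i).symm
  refine ⟨{
    gen := g
    root := fun j n => j.elim (u (k + n)) fun i => w i n
    root_zero := ?_
    root_succ := ?_
    zeta := u
    isPrimitiveRoot := hprim
    zeta_succ := hu
    zeta_add := fun _ => rfl
    span := exists_prod_mul_pow b hg
    indep := dvd_of_prod_eq_pow b hg
    faithful := ?_ }⟩
  · rintro (_ | i)
    · exact hj.symm
    · exact hw0 i
  · rintro (_ | i) n
    · exact hu (k + n)
    · exact hw i n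
  · exact fun s hs => galois_eq_one hs

end CyclotomicRadical

theorem theorem4p2 {F : Type u} [Field F] (p : ℕ) [Fact p.Prime]
    (hodd : p ≠ 2 → ∃ ζ : F, IsPrimitiveRoot ζ p)
    (htwo : p = 2 → ∃ ζ : F, IsPrimitiveRoot ζ 4)
    (k : ℕ) (hk : 1 ≤ k)
    (hmem : ∃ ζ : F, IsPrimitiveRoot ζ (p ^ k))
    (hnot : ¬ ∃ ζ : F, IsPrimitiveRoot ζ (p ^ (k + 1))) :
    IsGalois F (CyclotomicRadical.CR F p) ∧
    (∃ I : Type u, Cardinal.mk I + 1 = Module.rank (ZMod p) (ModN (Additive Fˣ) p)) ∧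
    ∀ I : Type u, Cardinal.mk I + 1 = Module.rank (ZMod p) (ModN (Additive Fˣ) p) →
      Nonempty (Gal(CyclotomicRadical.CR F p/F) ≃ₜ*
        CyclotomicRadical.ProPPresented p (CyclotomicRadical.crRelators p k I)) ∧
      ∃ e : CyclotomicRadical.ProPPresented p (CyclotomicRadical.crRelators p k I) ≃ₜ*
          CyclotomicRadical.CRSemidirect p k hk I,
        e (CyclotomicRadical.ProPPresented.of p _ none) =
          SemidirectProduct.inr (Multiplicative.ofAdd 1) ∧
        ∀ i : I, e (CyclotomicRadical.ProPPresented.of p _ (some i)) =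
          SemidirectProduct.inl (Multiplicative.ofAdd (by classical exact Pi.single i 1)) := by
  -- For `p = 2` and `k = 1` the primitive fourth root of unity would contradict `hnot`.
  have h2 : p = 2 → 2 ≤ k := by
    rintro rfl
    by_contra hlt
    obtain rfl : k = 1 := by omega
    exact hnot (by simpa using htwo rfl)
  have hgal := CyclotomicRadical.isGalois_CR F p
  refine ⟨hgal, ?_, fun I hI => ?_⟩
  · obtain ⟨ξ, hξ⟩ := hmem
    have hξ0 : ξ ≠ 0 := hξ.ne_zero (pow_ne_zero _ (Fact.out : p.Prime).ne_zero)
    have hne : ModN.mkQ p (Additive.ofMul (Units.mk0 ξ hξ0)) ≠ 0 := fun h =>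
      CyclotomicRadical.not_isPow_of_isPrimitiveRoot hk hnot (z := Units.mk0 ξ hξ0) hξ
        ((CyclotomicRadical.mkQ_eq_zero_iff _).1 h)
    have hnt : Nontrivial (ModN (Additive Fˣ) p) := ⟨_, _, hne⟩
    have h1 : 1 ≤ Module.rank (ZMod p) (ModN (Additive Fˣ) p) := Cardinal.one_le_iff_pos.2 rank_pos
    obtain ⟨d, hd⟩ := exists_add_of_le h1
    exact ⟨d.out, by rw [Cardinal.mk_out, hd, add_comm]⟩
  · obtain ⟨R⟩ := CyclotomicRadical.nonempty_radicalSystem hk hmem hnot hI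
    obtain ⟨e₁⟩ := R.nonempty_galois_equiv h2 hk
    obtain ⟨e, he⟩ := CyclotomicRadical.exists_presented_equiv p k hk I
    exact ⟨⟨e₁.trans e.symm⟩, e, he none, fun i => he (some i)⟩
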